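/- Let $G$ be a second countable locally compact abelian Hausdorff group (written additively) and let $M\le H\le G$ be countable uniform lattices, i.e. discrete subgroups with compact quotients $G/M$, $G/H$. Let $\widehat H$ be the (compact) dual group of $H$, written additively, with Haar measure normalized to total mass $1$; for $h\in H$ put $\chi_h(\gamma)=(h,\gamma)$, $\gamma\in\widehat H$, so that $\{\chi_h\}_{h\in H}$ is an orthonormal basis of $L^2(\widehat H)$. Let $M^\perp=\{\gamma\in\widehat H:(m,\gamma)=1\text{ for all }m\in M\}=\{\mu_0^\perp=0,\mu_1^\perp,\dots,\mu_{r-1}^\perp\}$, a finite group of order $r$, and let $\Omega\subset\widehat H$ be a Borel section of $\widehat H/M^\perp$, i.e. a measurable set such that $\widehat H$ is the disjoint union of the sets $\mu_k^\perp+\Omega$, $k=0,\dots,r-1$. Let $\mathcal H$ be a complex separable Hilbert space (inner product linear in the first argument), let $\Pi$ be a map from $G$ to the bounded invertible operators on $\mathcal H$ with $\Pi(g+g')=\Pi(g)\Pi(g')$, and let $a\in\mathcal H$ be such that $\{\Pi(h)a\}_{h\in H}$ is a Riesz sequence. Put $\mathcal A_a=\overline{\operatorname{span}}\{\Pi(h)a:h\in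 H\}$ and let $\mathcal T_{H,a}:L^2(\widehat H)\to\mathcal A_a$ be the isomorphism $\sum_{h}\alpha_h\chi_h\mapsto\sum_h\alpha_h\Pi(h)a$. Let $b_1,\dots,b_s\in\mathcal H$ and, for $x\in\mathcal A_a$ and $h\in H$, let $\mathcal L_jx(h)=\langle x,\Pi^*(-h)b_j\rangle$, where $\Pi^*(-h)$ is the adjoint of $\Pi(-h)$. Let $G_j=\sum_{k\in H}\mathcal L_ja(k)\,\chi_k\in L^2(\widehat H)$ (so that $\mathcal L_jx(m)=\langle F,\overline{G_j}\chi_m\rangle_{L^2(\widehat H)}$ for $x=\mathcal T_{H,a}F$ and $m\in M$), and assume that $G_j\in L^\infty(\widehat H)$ for $j=1,\dots,s$. Let $\mathbb G(\xi)=\big(G_j(\xi+\mu_k^\perp)\big)_{j=1,\dots,s;\,k=0,\dots,r-1}$, an $s\times r$ matrix, and $\alpha_{\mathbb G}=\operatorname{ess\,inf}_{\xi\in\Omega}\lambda_{\min}[\mathbb G^*(\xi)\mathbb G(\xi)]$, where $\lambda_{\min}$ denotes the smallest eigenvalue. The following statements are equivalent: (a) $\alpha_{\mathbb G}>0$. (b)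 There exist functions $H_1,\dots,H_s\in L^\infty(\widehat H)$ with $\big(H_1(\xi),\dots,H_s(\xi)\big)\,\mathbb G(\xi)=(1,0,\dots,0)$ for a.e. $\xi\in\widehat H$. (c) There exist $c_1,\dots,c_s\in\mathcal A_a$ such that $\{\Pi(m)c_j\}_{m\in M;\,j=1,\dots,s}$ is a frame for $\mathcal A_a$ and $x=\sum_{j=1}^s\sum_{m\in M}\mathcal L_jx(m)\,\Pi(m)c_j$ in $\mathcal H$ for every $x\in\mathcal A_a$. (d) There exists a frame $\{C_{j,m}\}_{m\in M;\,j=1,\dots,s}$ for $\mathcal A_a$ such that $x=\sum_{j=1}^s\sum_{m\in M}\mathcal L_jx(m)\,C_{j,m}$ in $\mathcal H$ for every $x\in\mathcal A_a$. Moreover, whenever $c_1,\dots,c_s$ are as in (c), there are functions $H_1,\dots,H_s\in L^\infty(\widehat H)$ satisfying the identity in (b) such that $c_j=\mathcal T_{H,a}(rH_j)$ for $j=1,\dots,s$. -/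

import Mathlib

open MeasureTheory
open scoped ENNReal Pointwise Matrix InnerProductSpace

noncomputable section

namespace LCASampling

/-- A uniform lattice of a topological abelian group: a discrete subgroup with compact quotient. -/
class IsUniformLattice {G : Type*} [AddCommGroup G] [TopologicalSpace G] (K : AddSubgroup G) :
    Prop where
  discrete : DiscreteTopology K
  cocompact : CompactSpace (G ⧸ K)

instance {G : Type*} [AddCommGroup G] [TopologicalSpace G] (K : AddSubgroup G)
    [IsUniformLattice K] : DiscreteTopology K := IsUniformLattice.discrete

/-! ### The dual group of a lattice -/

section Dual

variable {G : Type*} [AddCommGroup G] [TopologicalSpace G]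

/-- The dual group of `H`: the continuous characters of `H` with the topology of uniform
convergence on compact sets. Its group law is written multiplicatively. -/
abbrev Dual (H : AddSubgroup G) : Type _ := PontryaginDual (Multiplicative H)

instance (H : AddSubgroup G) : MeasurableSpace (Dual H) := borel _

instance (H : AddSubgroup G) : BorelSpace (Dual H) := ⟨rfl⟩

/-- The Haar measure of the compact group `Dual H`, normalized to total mass one. -/
def dualHaar (H : AddSubgroup G) [DiscreteTopology H] : Measure (Dual H) :=
  Measure.haarMeasure ⊤

instance (H : AddSubgroup G) [DiscreteTopology H] : IsProbabilityMeasure (dualHaar H) :=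
  ⟨by simpa [dualHaar] using Measure.haarMeasure_self (K₀ := (⊤ : TopologicalSpace.PositiveCompacts (Dual H)))⟩

/-- The function `χ_h : γ ↦ (h, γ)` on the dual group. -/
def chi (H : AddSubgroup G) (h : H) : C(Dual H, ℂ) where
  toFun γ := (γ (Multiplicative.ofAdd h) : ℂ)
  continuous_toFun :=
    continuous_subtype_val.comp
      (continuous_eval_const (F := Multiplicative H →ₜ* Circle) (Multiplicative.ofAdd h))

/-- `χ_h` as an element of `L²` of the dual group. -/
def chiL2 (H : AddSubgroup G) [DiscreteTopology H] (h : H) : Lp ℂ 2 (dualHaar H) :=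
  ContinuousMap.toLp 2 (dualHaar H) ℂ (chi H h)

/-- An essentially bounded function on the dual group, as an element of `L²`. -/
def linftyToL2 (H : AddSubgroup G) [DiscreteTopology H] (F : Dual H → ℂ)
    (hF : MemLp F ∞ (dualHaar H)) : Lp ℂ 2 (dualHaar H) :=
  (hF.mono_exponent le_top).toLp F

/-- The annihilator of `M` in the dual group of `H`. -/
def annihilator {H M : AddSubgroup G} (hMH : M ≤ H) : Subgroup (Dual H) where
  carrier := {γ | ∀ m : M, γ (Multiplicative.ofAdd ⟨m, hMH m.2⟩) = 1}
  one_mem' := fun _ => rfl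
  mul_mem' := fun {γ γ'} hγ hγ' m => by
    have : (γ * γ') (Multiplicative.ofAdd ⟨m, hMH m.2⟩) =
      γ (Multiplicative.ofAdd ⟨m, hMH m.2⟩) * γ' (Multiplicative.ofAdd ⟨m, hMH m.2⟩) := rfl
    rw [this, hγ m, hγ' m, one_mul]
  inv_mem' := fun {γ} hγ m => by
    have : γ⁻¹ (Multiplicative.ofAdd ⟨m, hMH m.2⟩) =
      (γ (Multiplicative.ofAdd ⟨m, hMH m.2⟩))⁻¹ := rfl
    rw [this, hγ m, inv_one]

/-- For nested uniform lattices `M ≤ H`, the quotient `H / M` is finite. -/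
theorem finite_quotient [IsTopologicalAddGroup G] [T2Space G] {H M : AddSubgroup G}
    [hH : IsUniformLattice H] [hM : IsUniformLattice M] (hMH : M ≤ H) :
    Finite (H ⧸ M.addSubgroupOf H) := by
  have := hM.cocompact
  have := hH.discrete
  have := hM.discrete
  have : IsClosed (M : Set G) := AddSubgroup.isClosed_of_discrete
  let q : G →+ G ⧸ M := QuotientAddGroup.mk' M
  let Q : AddSubgroup (G ⧸ M) := H.map q
  have hdisc : DiscreteTopology Q := by
    obtain ⟨U, hU, hUH⟩ : ∃ U : Set G, IsOpen U ∧ ((↑) : H → G) ⁻¹' U = {0} :=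
      isOpen_induced_iff.mp (isOpen_discrete ({0} : Set H))
    have hqU : IsOpen (q '' U) := QuotientAddGroup.isOpenMap_coe U hU
    refine discreteTopology_of_isOpen_singleton_zero ?_
    refine isOpen_induced_iff.mpr ⟨q '' U, hqU, ?_⟩
    ext ⟨y, hy⟩
    simp only [Set.mem_preimage, Set.mem_singleton_iff]
    constructor
    · rintro ⟨u, hu, huy⟩
      obtain ⟨h, hh, hhy⟩ := hy
      have huM : -u + h ∈ M := QuotientAddGroup.eq.mp (huy.trans hhy.symm)
      have huH : u ∈ H := by
        have := H.sub_mem hh (hMH huM)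
        simpa using this
      have : (⟨u, huH⟩ : H) ∈ ((↑) : H → G) ⁻¹' U := hu
      rw [hUH] at this
      have hu0 : u = 0 := congrArg Subtype.val this
      ext
      simp only [← huy, hu0, map_zero, ZeroMemClass.coe_zero]
    · intro h0
      have hy0 : y = 0 := congrArg Subtype.val h0
      have : (0 : H) ∈ ((↑) : H → G) ⁻¹' U := by rw [hUH]; rfl
      exact ⟨0, this, by rw [hy0, map_zero]⟩
  have hcl : IsClosed (Q : Set (G ⧸ M)) := AddSubgroup.isClosed_of_discrete
  have : CompactSpace Q := isCompact_iff_compactSpace.mp hcl.isCompact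
  have : Finite Q := finite_of_compact_of_discrete
  let f : H →+ Q := (q.comp H.subtype).codRestrict Q (fun h => ⟨h, h.2, rfl⟩)
  refine Finite.of_injective (fun x : H ⧸ M.addSubgroupOf H => f x.out) ?_
  intro x y hxy
  have h1 : q (x.out : G) = q (y.out : G) := congrArg Subtype.val hxy
  have h2 : -(x.out : G) + (y.out : G) ∈ M := QuotientAddGroup.eq.mp h1
  rw [← QuotientAddGroup.out_eq' x, ← QuotientAddGroup.out_eq' y]
  exact QuotientAddGroup.eq.mpr h2

instance finite_annihilator [IsTopologicalAddGroup G] [T2Space G] {H M : AddSubgroup G}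
    [IsUniformLattice H] [IsUniformLattice M] (hMH : M ≤ H) : Finite (annihilator hMH) := by
  have := finite_quotient hMH
  let N := M.addSubgroupOf H
  let n := Nat.card (H ⧸ N)
  have hn : 0 < n := Nat.card_pos
  have hval : ∀ γ ∈ annihilator hMH, ∀ x : H, x ∈ N → γ (Multiplicative.ofAdd x) = 1 :=
    fun γ hγ x hx => hγ ⟨x, hx⟩
  have : Finite {z : ℂ // z ^ n = 1} := by
    refine Finite.of_injective
      (fun z => (⟨z.1, (Polynomial.mem_nthRootsFinset hn (1 : ℂ)).mpr z.2⟩ :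
        {z : ℂ // z ∈ Polynomial.nthRootsFinset n (1 : ℂ)})) ?_
    intro z w h
    exact Subtype.ext (Subtype.mk.inj h)
  refine Finite.of_injective (fun (γ : annihilator hMH) (x : H ⧸ N) =>
    (⟨(γ.1 (Multiplicative.ofAdd x.out) : ℂ), ?_⟩ : {z : ℂ // z ^ n = 1})) ?_
  · have hmem : n • x.out ∈ N := by
      rw [← QuotientAddGroup.eq_zero_iff, QuotientAddGroup.mk_nsmul]
      exact card_nsmul_eq_zero'
    have := hval γ.1 γ.2 _ hmem
    rw [ofAdd_nsmul, map_pow] at this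
    exact_mod_cast congrArg (fun z : Circle => (z : ℂ)) this
  · intro γ γ' h
    ext1
    refine PontryaginDual.ext fun x => ?_
    let y : H := x.toAdd
    let t : H := (QuotientAddGroup.mk y : H ⧸ N).out
    have ht : -t + y ∈ N :=
      QuotientAddGroup.eq.mp (QuotientAddGroup.out_eq' (QuotientAddGroup.mk y : H ⧸ N))
    have key : ∀ δ ∈ annihilator hMH, δ x = δ (Multiplicative.ofAdd t) := fun δ hδ => by
      have hx : x = Multiplicative.ofAdd t * Multiplicative.ofAdd (-t + y) := by
        rw [← ofAdd_add, add_neg_cancel_left]; rfl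
      rw [hx, map_mul, hval δ hδ _ ht, mul_one]
    rw [key _ γ.2, key _ γ'.2]
    have := congrFun h (QuotientAddGroup.mk y)
    exact Circle.ext (Subtype.mk.inj this)

instance [IsTopologicalAddGroup G] [T2Space G] {H M : AddSubgroup G}
    [IsUniformLattice H] [IsUniformLattice M] (hMH : M ≤ H) : Fintype (annihilator hMH) :=
  Fintype.ofFinite _

/-- A Borel section of the quotient of the dual group of `H` by the annihilator of `M`: a
measurable set whose translates by the elements of the annihilator partition the dual group. -/
structure IsSection {H M : AddSubgroup G} (hMH : M ≤ H) (Ω : Set (Dual H)) : Prop where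
  measurableSet : MeasurableSet Ω
  iUnion_eq : ⋃ ν : annihilator hMH, (ν : Dual H) • Ω = Set.univ
  disjoint : Pairwise fun ν ν' : annihilator hMH =>
    Disjoint ((ν : Dual H) • Ω) ((ν' : Dual H) • Ω)

end Dual

/-! ### Frames and Riesz sequences -/

section Frames

variable {E : Type*} [NormedAddCommGroup E] [InnerProductSpace ℂ E]

/-- `u` is a Riesz sequence: a Riesz basis of its closed linear span. -/
def IsRieszSequence {ι : Type*} (u : ι → E) : Prop :=
  ∃ A B : ℝ, 0 < A ∧ 0 < B ∧ ∀ α : ι →₀ ℂ,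
    A * (α.sum fun _ z => ‖z‖ ^ 2) ≤ ‖α.sum fun i z => z • u i‖ ^ 2 ∧
      ‖α.sum fun i z => z • u i‖ ^ 2 ≤ B * (α.sum fun _ z => ‖z‖ ^ 2)

/-- `u` is a frame for the subspace `V`. -/
def IsFrameFor {ι : Type*} (u : ι → E) (V : Submodule ℂ E) : Prop :=
  (∀ i, u i ∈ V) ∧ ∃ A B : ℝ, 0 < A ∧ 0 < B ∧ ∀ x ∈ V,
    Summable (fun i => ‖⟪u i, x⟫_ℂ‖ ^ 2) ∧
      A * ‖x‖ ^ 2 ≤ ∑' i, ‖⟪u i, x⟫_ℂ‖ ^ 2 ∧ ∑' i, ‖⟪u i, x⟫_ℂ‖ ^ 2 ≤ B * ‖x‖ ^ 2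

end Frames

/-! ### The sampling problem -/

section Sampling

variable {G : Type*} [AddCommGroup G] [TopologicalSpace G]
  {E : Type*} [NormedAddCommGroup E] [InnerProductSpace ℂ E]

/-- The bounded operator `Π(g)` of a representation `Π` of the additive group `G` by bounded
invertible operators. -/
def op (ρ : Multiplicative G →* (E ≃L[ℂ] E)) (g : G) : E →L[ℂ] E :=
  (ρ (Multiplicative.ofAdd g) : E →L[ℂ] E)

/-- The subspace `𝒜_a`, the closed linear span of `Π(h) a`, `h ∈ H`. -/
def genSubspace (ρ : Multiplicative G →* (E ≃L[ℂ] E)) (H : AddSubgroup G) (a : E) :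
    Submodule ℂ E :=
  (Submodule.span ℂ (Set.range fun h : H => op ρ h a)).topologicalClosure

/-- The sample `ℒx(g) = ⟨x, Π*(-g) b⟩`, where the inner product of the text, linear in its first
argument, is Mathlib's with the arguments exchanged. -/
def sample [CompleteSpace E] (ρ : Multiplicative G →* (E ≃L[ℂ] E)) (b x : E) (g : G) : ℂ :=
  ⟪ContinuousLinearMap.adjoint (op ρ (-g)) b, x⟫_ℂ

/-- The map `𝒯_{H,a}`, sending `F = ∑ α_h χ_h` in `L²` of the dual group to `∑ α_h Π(h) a`. The
`χ_h` are orthonormal, so `α_h = ⟨F, χ_h⟩`. The series converges unconditionally whenever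
`Π(h) a`, `h ∈ H`, is a Riesz sequence. -/
def synth (ρ : Multiplicative G →* (E ≃L[ℂ] E)) (H : AddSubgroup G) [DiscreteTopology H] (a : E)
    (F : Lp ℂ 2 (dualHaar H)) : E :=
  ∑' h : H, ⟪chiL2 H h, F⟫_ℂ • op ρ h a

/-- The function `∑ ℒa(k) χ_k`, `k ∈ H`, in `L²` of the dual group, attached to `b`. The series
converges unconditionally in `L²` whenever `Π(h) a`, `h ∈ H`, is a Riesz sequence. -/
def sampleFun [CompleteSpace E] (ρ : Multiplicative G →* (E ≃L[ℂ] E)) (H : AddSubgroup G)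
    [DiscreteTopology H] (a b : E) : Lp ℂ 2 (dualHaar H) :=
  ∑' k : H, sample ρ b a k • chiL2 H k

end Sampling

/-! ### The matrix of translates and its constant -/

section Matrices

open Classical in
/-- The smallest eigenvalue of `Aᴴ A`. -/
def lambdaMin {m n : Type*} [Fintype m] [Fintype n] (A : Matrix m n ℂ) : ℝ :=
  ⨅ i, (Matrix.isHermitian_conjTranspose_mul_self A).eigenvalues i

variable {G : Type*} [AddCommGroup G] [TopologicalSpace G]

/-- The matrix with entries `Γ_j (ξ + ν)`, with rows indexed by `j = 1, …, s` and columns by the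
elements `ν` of the annihilator of `M`. -/
def translateMatrix {H M : AddSubgroup G} (hMH : M ≤ H) {s : ℕ} (Γ : Fin s → Dual H → ℂ)
    (ξ : Dual H) : Matrix (Fin s) (annihilator hMH) ℂ :=
  Matrix.of fun j ν => Γ j (ξ * ν)

/-- The essential infimum over `Ω` of the smallest eigenvalue (a nonnegative number) of
`𝔾(ξ)ᴴ 𝔾(ξ)`. -/
def alphaConst [IsTopologicalAddGroup G] [T2Space G] {H M : AddSubgroup G} [IsUniformLattice H]
    [IsUniformLattice M] (hMH : M ≤ H) {s : ℕ} (Γ : Fin s → Dual H → ℂ) (Ω : Set (Dual H)) :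
    ℝ≥0∞ :=
  essInf (fun ξ => ENNReal.ofReal (lambdaMin (translateMatrix hMH Γ ξ)))
    ((dualHaar H).restrict Ω)

open Classical in
/-- The row vector `(1, 0, …, 0)`, the first column being that of the neutral element. -/
def firstRow {H M : AddSubgroup G} (hMH : M ≤ H) : annihilator hMH → ℂ :=
  Pi.single 1 1

end Matrices

end LCASampling

end

/-!
The map `𝒯` carries `L²` of the dual group onto `𝒜_a` and turns `Π(h)` into multiplication by `χ_h`.
The samples `ℒ_j x(m)`, `m ∈ M`, of `x = 𝒯 F` are Fourier coefficients of `G_j F` at frequencies in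
`M`, hence the coefficients of the average of `G_j F` over the translates by `M^⊥`. Consequently
reconstruction with `c_j = 𝒯 (r H_j)` acts on each fibre of `Dual H → Dual H / M^⊥` as a matrix
product, and is the identity exactly when `(H_1, …, H_s) 𝔾 = (1, 0, …, 0)`.

If `α_𝔾 > 0`, the first row of the Moore-Penrose inverse of `𝔾` is bounded and solves this equation.
Conversely, reconstruction with any frame gives `‖F‖² ≤ B ∑ ‖average (G_j F)‖²`; tested on functions
that are constant on the translates of a small subset of `Ω`, this bounds the smallest eigenvalue of
`𝔾ᴴ 𝔾` from below almost everywhere. The same test functions show that the Bessel property of the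
translates `Π(m) c_j` forces `𝒯⁻¹ c_j` to be essentially bounded.
-/

noncomputable section

namespace LCASampling

open scoped ComplexConjugate

section Bessel

variable {ι κ E E' : Type*} [NormedAddCommGroup E] [InnerProductSpace ℂ E]
  [NormedAddCommGroup E'] [InnerProductSpace ℂ E']

/-- `u` is a Bessel sequence: it satisfies the upper inequality of a frame. The bound is required
of finite partial sums, so that it includes the convergence of the full sum. -/
def IsBessel (u : ι → E) : Prop :=
  ∃ B : ℝ, 0 ≤ B ∧ ∀ (x : E) (t : Finset ι), ∑ i ∈ t, ‖⟪u i, x⟫_ℂ‖ ^ 2 ≤ B * ‖x‖ ^ 2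

lemma isBessel_of_orthonormal {u : ι → E} (hu : Orthonormal ℂ u) : IsBessel u :=
  ⟨1, zero_le_one, fun x t => by simpa using hu.sum_inner_products_le x⟩

lemma IsBessel.comp_injective {u : ι → E} (hu : IsBessel u) {f : κ → ι}
    (hf : Function.Injective f) : IsBessel (u ∘ f) := by
  obtain ⟨B, hB, hBu⟩ := hu
  exact ⟨B, hB, fun x t => by simpa using hBu x (t.map ⟨f, hf⟩)⟩

lemma IsBessel.map [CompleteSpace E] [CompleteSpace E'] {u : ι → E} (hu : IsBessel u)
    (S : E →L[ℂ] E') : IsBessel fun i => S (u i) := by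
  obtain ⟨B, hB, hBu⟩ := hu
  refine ⟨B * ‖S.adjoint‖ ^ 2, by positivity, fun x t => ?_⟩
  calc ∑ i ∈ t, ‖⟪S (u i), x⟫_ℂ‖ ^ 2
      = ∑ i ∈ t, ‖⟪u i, S.adjoint x⟫_ℂ‖ ^ 2 := by
        simp only [ContinuousLinearMap.adjoint_inner_right]
    _ ≤ B * ‖S.adjoint x‖ ^ 2 := hBu _ t
    _ ≤ B * (‖S.adjoint‖ * ‖x‖) ^ 2 := by gcongr; exact S.adjoint.le_opNorm x
    _ = B * ‖S.adjoint‖ ^ 2 * ‖x‖ ^ 2 := by ring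

lemma IsBessel.prod [Finite κ] {u : κ × ι → E} (hu : ∀ j, IsBessel fun i => u (j, i)) :
    IsBessel u := by
  classical
  have := Fintype.ofFinite κ
  choose B hB hBu using hu
  refine ⟨∑ j, B j, Finset.sum_nonneg fun j _ => hB j, fun x t => ?_⟩
  calc ∑ p ∈ t, ‖⟪u p, x⟫_ℂ‖ ^ 2
      ≤ ∑ p ∈ Finset.univ ×ˢ t.image Prod.snd, ‖⟪u p, x⟫_ℂ‖ ^ 2 :=
        Finset.sum_le_sum_of_subset_of_nonneg
          (fun p hp => Finset.mem_product.mpr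
            ⟨Finset.mem_univ _, Finset.mem_image_of_mem Prod.snd hp⟩)
          fun _ _ _ => by positivity
    _ = ∑ j, ∑ i ∈ t.image Prod.snd, ‖⟪u (j, i), x⟫_ℂ‖ ^ 2 := Finset.sum_product _ _ _
    _ ≤ ∑ j, B j * ‖x‖ ^ 2 := Finset.sum_le_sum fun j _ => hBu j x _
    _ = (∑ j, B j) * ‖x‖ ^ 2 := (Finset.sum_mul _ _ _).symm

lemma IsFrameFor.isBessel {V : Submodule ℂ E} [V.HasOrthogonalProjection] {u : ι → E}
    (hu : IsFrameFor u V) : IsBessel u := by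
  obtain ⟨huV, A, B, -, hB, hAB⟩ := hu
  refine ⟨B, hB.le, fun x t => ?_⟩
  have inner_eq : ∀ i, ⟪u i, x⟫_ℂ = ⟪u i, V.starProjection x⟫_ℂ := fun i => by
    rw [← V.inner_starProjection_left_eq_right, V.starProjection_eq_self_iff.mpr (huV i)]
  obtain ⟨hsum, -, hle⟩ := hAB _ (V.starProjection_apply_mem x)
  calc ∑ i ∈ t, ‖⟪u i, x⟫_ℂ‖ ^ 2
      = ∑ i ∈ t, ‖⟪u i, V.starProjection x⟫_ℂ‖ ^ 2 := by simp only [inner_eq]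
    _ ≤ ∑' i, ‖⟪u i, V.starProjection x⟫_ℂ‖ ^ 2 := hsum.sum_le_tsum t fun _ _ => by positivity
    _ ≤ B * ‖V.starProjection x‖ ^ 2 := hle
    _ ≤ B * ‖x‖ ^ 2 := by gcongr; exact V.norm_starProjection_apply_le x

lemma norm_sq_sq_le_of_hasSum {u : ι → E} {l : ι → ℂ} {x : E} (hx : HasSum (fun i => l i • u i) x)
    {L C : ℝ} (hL : ∀ t : Finset ι, ∑ i ∈ t, ‖l i‖ ^ 2 ≤ L)
    (hC : ∀ t : Finset ι, ∑ i ∈ t, ‖⟪u i, x⟫_ℂ‖ ^ 2 ≤ C) : (‖x‖ ^ 2) ^ 2 ≤ L * C := by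
  have hL0 : 0 ≤ L := by simpa using hL ∅
  have norm_inner : ‖⟪x, x⟫_ℂ‖ = ‖x‖ ^ 2 := by
    rw [inner_self_eq_norm_sq_to_K, norm_pow, RCLike.norm_ofReal, abs_norm]
  rw [← norm_inner]
  refine le_of_tendsto' ((hx.mapL (innerSL ℂ x)).norm.pow 2) fun t => ?_
  calc ‖∑ i ∈ t, innerSL ℂ x (l i • u i)‖ ^ 2
      ≤ (∑ i ∈ t, ‖innerSL ℂ x (l i • u i)‖) ^ 2 := by gcongr; exact norm_sum_le _ _
    _ = (∑ i ∈ t, ‖l i‖ * ‖⟪u i, x⟫_ℂ‖) ^ 2 := by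
        simp only [innerSL_apply_apply, inner_smul_right, norm_mul, norm_inner_symm x]
    _ ≤ (∑ i ∈ t, ‖l i‖ ^ 2) * ∑ i ∈ t, ‖⟪u i, x⟫_ℂ‖ ^ 2 := Finset.sum_mul_sq_le_sq_mul_sq _ _ _
    _ ≤ L * C := by gcongr; exacts [hL t, hC t]

lemma IsBessel.exists_norm_sq_le_of_hasSum {u : ι → E} (hu : IsBessel u) :
    ∃ B : ℝ, 0 ≤ B ∧ ∀ (l : ι → ℂ) (x : E) (L : ℝ), HasSum (fun i => l i • u i) x →
      HasSum (fun i => ‖l i‖ ^ 2) L → ‖x‖ ^ 2 ≤ B * L := by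
  obtain ⟨B, hB, hBu⟩ := hu
  refine ⟨B, hB, fun l x L hx hL => ?_⟩
  have hL_le : ∀ t : Finset ι, ∑ i ∈ t, ‖l i‖ ^ 2 ≤ L := fun t =>
    sum_le_hasSum t (fun _ _ => by positivity) hL
  have hL0 : 0 ≤ L := by simpa using hL_le ∅
  have := norm_sq_sq_le_of_hasSum hx hL_le (hBu x)
  by_contra! hlt
  have hpos : 0 < ‖x‖ ^ 2 := lt_of_le_of_lt (by positivity) hlt
  nlinarith [mul_lt_mul_of_pos_right hlt hpos]

lemma IsFrameFor.of_isBessel_of_hasSum {V : Submodule ℂ E} {u g : ι → E} (huV : ∀ i, u i ∈ V)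
    (hu : IsBessel u) (hg : IsBessel g)
    (hug : ∀ x ∈ V, HasSum (fun i => ⟪g i, x⟫_ℂ • u i) x) : IsFrameFor u V := by
  obtain ⟨B, hB, hBu⟩ := hu
  obtain ⟨C, hC, hCg⟩ := hg
  refine ⟨huV, (C + 1)⁻¹, B + 1, by positivity, by positivity, fun x hx => ?_⟩
  have hsum : Summable fun i => ‖⟪u i, x⟫_ℂ‖ ^ 2 :=
    summable_of_sum_le (fun _ => by positivity) (hBu x)
  have hle : ∀ t : Finset ι, ∑ i ∈ t, ‖⟪u i, x⟫_ℂ‖ ^ 2 ≤ ∑' i, ‖⟪u i, x⟫_ℂ‖ ^ 2 := fun t =>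
    hsum.sum_le_tsum t fun _ _ => by positivity
  have hS0 : 0 ≤ ∑' i, ‖⟪u i, x⟫_ℂ‖ ^ 2 := by simpa using hle ∅
  refine ⟨hsum, ?_, ?_⟩
  · have := norm_sq_sq_le_of_hasSum (hug x hx) (hCg x) hle
    rw [inv_mul_le_iff₀ (by positivity)]
    by_contra! hlt
    have hpos : 0 < ‖x‖ ^ 2 := lt_of_le_of_lt (by positivity) hlt
    nlinarith [mul_lt_mul_of_pos_right hlt hpos, mul_nonneg hS0 hpos.le]
  · have htsum : ∑' i, ‖⟪u i, x⟫_ℂ‖ ^ 2 ≤ B * ‖x‖ ^ 2 := hsum.tsum_le_of_sum_le (hBu x)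
    nlinarith [sq_nonneg ‖x‖]

end Bessel

section Riesz

variable {ι 𝓕 E : Type*} [NormedAddCommGroup 𝓕] [InnerProductSpace ℂ 𝓕]
  [NormedAddCommGroup E] [InnerProductSpace ℂ E] {u : ι → E}

lemma hasSum_norm_sq_inner_hilbertBasis (b : HilbertBasis ι ℂ 𝓕) (F : 𝓕) :
    HasSum (fun i => ‖⟪b i, F⟫_ℂ‖ ^ 2) (‖F‖ ^ 2) := by
  simpa [b.repr_apply_apply, b.repr.norm_map] using
    lp.hasSum_norm (p := 2) (by norm_num) (b.repr F)

lemma IsRieszSequence.exists_sum_bounds (hu : IsRieszSequence u) :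
    ∃ A B : ℝ, 0 < A ∧ 0 < B ∧ ∀ (α : ι → ℂ) (t : Finset ι),
      A * ∑ i ∈ t, ‖α i‖ ^ 2 ≤ ‖∑ i ∈ t, α i • u i‖ ^ 2 ∧
        ‖∑ i ∈ t, α i • u i‖ ^ 2 ≤ B * ∑ i ∈ t, ‖α i‖ ^ 2 := by
  classical
  obtain ⟨A, B, hA, hB, hAB⟩ := hu
  refine ⟨A, B, hA, hB, fun α t => ?_⟩
  have bounds := hAB (Finsupp.onFinset t (fun i => if i ∈ t then α i else 0) fun i hi => by
    by_contra hit
    exact hi (if_neg hit))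
  rw [Finsupp.onFinset_sum _ (by simp), Finsupp.onFinset_sum _ (by simp)] at bounds
  have sum_sq : ∑ i ∈ t, ‖if i ∈ t then α i else 0‖ ^ 2 = ∑ i ∈ t, ‖α i‖ ^ 2 :=
    Finset.sum_congr rfl fun i hi => by rw [if_pos hi]
  have sum_smul : ∑ i ∈ t, (if i ∈ t then α i else 0) • u i = ∑ i ∈ t, α i • u i :=
    Finset.sum_congr rfl fun i hi => by rw [if_pos hi]
  rwa [sum_sq, sum_smul] at bounds

lemma IsRieszSequence.summable_smul [CompleteSpace E] (hu : IsRieszSequence u) {α : ι → ℂ}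
    (hα : Summable fun i => ‖α i‖ ^ 2) : Summable fun i => α i • u i := by
  obtain ⟨_, B, _, hB, hAB⟩ := hu.exists_sum_bounds
  rw [summable_iff_vanishing_norm]
  intro ε hε
  obtain ⟨s, hs⟩ := summable_iff_vanishing_norm.mp hα (ε ^ 2 / B) (by positivity)
  refine ⟨s, fun t ht => ?_⟩
  have tail_lt := hs t ht
  rw [Real.norm_of_nonneg (Finset.sum_nonneg fun i _ => by positivity), lt_div_iff₀' hB] at tail_lt
  exact lt_of_pow_lt_pow_left₀ 2 hε.le ((hAB α t).2.trans_lt tail_lt)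

variable [CompleteSpace E]

lemma IsRieszSequence.summable_inner_smul (hu : IsRieszSequence u) (b : HilbertBasis ι ℂ 𝓕)
    (F : 𝓕) : Summable fun i => ⟪b i, F⟫_ℂ • u i :=
  hu.summable_smul (hasSum_norm_sq_inner_hilbertBasis b F).summable

lemma IsRieszSequence.exists_norm_tsum_bounds (hu : IsRieszSequence u) (b : HilbertBasis ι ℂ 𝓕) :
    ∃ A B : ℝ, 0 < A ∧ 0 < B ∧ ∀ F : 𝓕,
      A * ‖F‖ ≤ ‖∑' i, ⟪b i, F⟫_ℂ • u i‖ ∧ ‖∑' i, ⟪b i, F⟫_ℂ • u i‖ ≤ B * ‖F‖ := by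
  obtain ⟨A, B, hA, hB, hAB⟩ := hu.exists_sum_bounds
  refine ⟨√A, √B, Real.sqrt_pos.mpr hA, Real.sqrt_pos.mpr hB, fun F => ?_⟩
  have norm_sums := ((hu.summable_inner_smul b F).hasSum.norm).pow 2
  have sum_sq := hasSum_norm_sq_inner_hilbertBasis b F
  constructor <;> refine le_of_sq_le_sq ?_ (by positivity) <;>
    rw [mul_pow, Real.sq_sqrt (by positivity)]
  · exact le_of_tendsto_of_tendsto' (sum_sq.const_mul A) norm_sums fun t => (hAB _ t).1
  · exact le_of_tendsto_of_tendsto' norm_sums (sum_sq.const_mul B) fun t => (hAB _ t).2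

/-- The synthesis operator of a Riesz sequence: it carries the orthonormal basis `b` to the
sequence `u`. -/
def IsRieszSequence.synthesis (hu : IsRieszSequence u) (b : HilbertBasis ι ℂ 𝓕) : 𝓕 →L[ℂ] E :=
  LinearMap.mkContinuousOfExistsBound
    { toFun := fun F => ∑' i, ⟪b i, F⟫_ℂ • u i
      map_add' := fun F F' => by
        simp only [inner_add_right, add_smul]
        exact (hu.summable_inner_smul b F).tsum_add (hu.summable_inner_smul b F')
      map_smul' := fun c F => by
        simp only [inner_smul_right, mul_smul, RingHom.id_apply]
        exact (hu.summable_inner_smul b F).tsum_const_smul c }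
    (let ⟨_, B, _, _, hAB⟩ := hu.exists_norm_tsum_bounds b
     ⟨B, fun F => (hAB F).2⟩)

lemma IsRieszSequence.synthesis_apply (hu : IsRieszSequence u) (b : HilbertBasis ι ℂ 𝓕) (F : 𝓕) :
    hu.synthesis b F = ∑' i, ⟪b i, F⟫_ℂ • u i := rfl

lemma IsRieszSequence.synthesis_basis (hu : IsRieszSequence u) (b : HilbertBasis ι ℂ 𝓕) (i : ι) :
    hu.synthesis b (b i) = u i := by
  classical
  rw [hu.synthesis_apply, tsum_eq_single i fun k hk => by
    rw [orthonormal_iff_ite.mp b.orthonormal, if_neg hk, zero_smul],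
    orthonormal_iff_ite.mp b.orthonormal, if_pos rfl, one_smul]

lemma IsRieszSequence.exists_antilipschitzWith_synthesis (hu : IsRieszSequence u)
    (b : HilbertBasis ι ℂ 𝓕) : ∃ K, AntilipschitzWith K (hu.synthesis b) := by
  obtain ⟨A, _, hA, _, hAB⟩ := hu.exists_norm_tsum_bounds b
  refine ⟨⟨A⁻¹, by positivity⟩, AddMonoidHomClass.antilipschitz_of_bound _ fun F => ?_⟩
  exact (le_inv_mul_iff₀ hA).mpr (hAB F).1

lemma IsRieszSequence.range_synthesis [CompleteSpace 𝓕] (hu : IsRieszSequence u)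
    (b : HilbertBasis ι ℂ 𝓕) :
    (hu.synthesis b).range = (Submodule.span ℂ (Set.range u)).topologicalClosure := by
  apply le_antisymm
  · rintro _ ⟨F, rfl⟩
    refine (Submodule.isClosed_topologicalClosure _).mem_of_tendsto
      (hu.summable_inner_smul b F).hasSum (Filter.Eventually.of_forall fun t => ?_)
    exact Submodule.le_topologicalClosure _ (Submodule.sum_mem _ fun i _ =>
      Submodule.smul_mem _ _ (Submodule.subset_span ⟨i, rfl⟩))
  · refine Submodule.topologicalClosure_minimal _ (Submodule.span_le.mpr ?_) ?_
    · rintro _ ⟨i, rfl⟩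
      exact ⟨b i, hu.synthesis_basis b i⟩
    · obtain ⟨K, hK⟩ := hu.exists_antilipschitzWith_synthesis b
      exact hK.isClosed_range (hu.synthesis b).uniformContinuous

lemma exists_leftInverse_of_antilipschitzWith [CompleteSpace 𝓕] {T : 𝓕 →L[ℂ] E} {K : NNReal}
    (hT : AntilipschitzWith K T) : ∃ S : E →L[ℂ] 𝓕, ∀ F, S (T F) = F := by
  have hclosed : IsClosed (Set.range T) := hT.isClosed_range T.uniformContinuous
  have : CompleteSpace T.range := hclosed.completeSpace_coe
  refine ⟨(T.equivRange hT.injective hclosed).symm ∘L T.range.orthogonalProjectionOnto,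
    fun F => ?_⟩
  rw [ContinuousLinearMap.comp_apply,
    T.range.orthogonalProjectionOnto_mem_subspace_eq_self ⟨T F, F, rfl⟩]
  exact T.equivRange_symm_apply hT.injective hclosed F

end Riesz

section Multiplication

lemma enorm_sq_eq_ofReal {V : Type*} [NormedAddCommGroup V] (v : V) :
    ‖v‖ₑ ^ 2 = ENNReal.ofReal (‖v‖ ^ 2) := by
  rw [ENNReal.ofReal_pow (norm_nonneg _), ofReal_norm]

lemma sum_enorm_sq_eq_ofReal {ι V : Type*} [NormedAddCommGroup V] (t : Finset ι) (v : ι → V) :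
    ∑ i ∈ t, ‖v i‖ₑ ^ 2 = ENNReal.ofReal (∑ i ∈ t, ‖v i‖ ^ 2) := by
  simp only [ENNReal.ofReal_sum_of_nonneg fun i (_ : i ∈ t) => sq_nonneg ‖v i‖, enorm_sq_eq_ofReal]

variable {α : Type*} [MeasurableSpace α] {μ : Measure α}

lemma enorm_sq_eq_lintegral (f : Lp ℂ 2 μ) : ‖f‖ₑ ^ 2 = ∫⁻ ξ, ‖f ξ‖ₑ ^ 2 ∂μ := by
  simpa [Lp.enorm_def] using
    eLpNorm_nnreal_pow_eq_lintegral (f := f) (μ := μ) (p := 2) two_ne_zero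

/-- Multiplication by an essentially bounded function, as an operator on `L²`. -/
def mulOp {g : α → ℂ} (hg : MemLp g ∞ μ) : Lp ℂ 2 μ →L[ℂ] Lp ℂ 2 μ :=
  (ContinuousLinearMap.mul ℂ ℂ).holderL μ ∞ 2 2 (hg.toLp g)

lemma coeFn_mulOp {g : α → ℂ} (hg : MemLp g ∞ μ) (f : Lp ℂ 2 μ) :
    mulOp hg f =ᵐ[μ] fun ξ => g ξ * f ξ := by
  filter_upwards [(ContinuousLinearMap.mul ℂ ℂ).coeFn_holder (r := 2) (hg.toLp g) f,
    hg.coeFn_toLp] with ξ h_holder h_toLp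
  rw [← h_toLp]
  exact h_holder

lemma inner_mulOp_toLp_star [IsFiniteMeasure μ] {g g' : α → ℂ} (hg : MemLp g ∞ μ)
    (hg' : MemLp g' ∞ μ) (f : Lp ℂ 2 μ) :
    ⟪mulOp hg f, (hg'.mono_exponent le_top).toLp g'⟫_ℂ =
      ⟪(hg.mono_exponent le_top).toLp g, mulOp hg' (star f)⟫_ℂ := by
  rw [L2.inner_def, L2.inner_def]
  refine integral_congr_ae ?_
  filter_upwards [coeFn_mulOp hg f, coeFn_mulOp hg' (star f), Lp.coeFn_star f,
    (hg.mono_exponent le_top : MemLp g 2 μ).coeFn_toLp,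
    (hg'.mono_exponent le_top : MemLp g' 2 μ).coeFn_toLp] with ξ h_left h_right h_star h_g h_g'
  rw [h_left, h_right, h_g, h_g', h_star, RCLike.inner_apply, RCLike.inner_apply, map_mul,
    Pi.star_apply, starRingEnd_apply, starRingEnd_apply]
  ring

end Multiplication

section FiniteGroupAction

variable {N α : Type*} [Group N] [MulAction N α] [MeasurableSpace α] {μ : Measure α} {Ω : Set α}

lemma ae_exists_forall_mem_smul_iff [Countable N] (hΩ : IsFundamentalDomain N Ω μ) :
    ∀ᵐ ξ ∂μ, ∃ κ : N, ∀ ν : N, ξ ∈ ν • Ω ↔ ν = κ := by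
  have ae_unique : ∀ᵐ ξ ∂μ, ∀ ν κ : N, ν ≠ κ → ξ ∉ ν • Ω ∩ κ • Ω :=
    ae_all_iff.mpr fun ν => ae_all_iff.mpr fun κ => by
      by_cases h : ν = κ
      · exact Filter.Eventually.of_forall fun _ hne => absurd h hne
      · filter_upwards [measure_eq_zero_iff_ae_notMem.mp (hΩ.aedisjoint h)] with ξ hξ _ using hξ
  filter_upwards [hΩ.ae_covers, ae_unique] with ξ ⟨κ, hκ⟩ hunique
  have hmem : ξ ∈ κ⁻¹ • Ω := Set.mem_inv_smul_set_iff.mpr hκ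
  refine ⟨κ⁻¹, fun ν => ⟨fun hν => ?_, fun h => h ▸ hmem⟩⟩
  by_contra hne
  exact hunique ν κ⁻¹ hne ⟨hν, hmem⟩

/-- The function equal to `v ν` on the translate of `A` by `ν`. With `A` inside a fundamental
domain, these functions probe the values of a function along single orbits. -/
def orbitStep [Fintype N] (v : N → ℂ) (A : Set α) (ξ : α) : ℂ :=
  ∑ ν : N, (ν • A).indicator (fun _ => v ν) ξ

lemma ae_orbitStep_smul [Fintype N] (hΩ : IsFundamentalDomain N Ω μ) (v : N → ℂ)
    {A : Set α} (hA : A ⊆ Ω) :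
    ∀ᵐ ξ ∂μ.restrict Ω, ∀ ν : N, orbitStep v A (ν • ξ) = A.indicator (fun _ => v ν) ξ := by
  classical
  refine (ae_restrict_iff'₀ hΩ.nullMeasurableSet).mpr ?_
  filter_upwards [ae_exists_forall_mem_smul_iff hΩ] with ξ ⟨κ, hκ⟩ hξ ν
  obtain rfl : 1 = κ := (hκ 1).mp (by rwa [one_smul])
  rw [orbitStep, Finset.sum_eq_single ν _ (by simp)]
  · simp only [Set.indicator, Set.smul_mem_smul_set_iff]
  · intro ν' _ hne
    refine Set.indicator_of_notMem (fun hmem => hne ?_) _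
    have : ξ ∈ (ν⁻¹ * ν') • Ω := by
      rw [mul_smul, Set.mem_inv_smul_set_iff]
      exact Set.smul_set_mono hA hmem
    exact (inv_mul_eq_one.mp ((hκ _).mp this)).symm

lemma memLp_orbitStep [Fintype N] [MeasurableConstSMul N α] (v : N → ℂ)
    {A : Set α} (hA : MeasurableSet A) :
    MemLp (orbitStep v A) ∞ μ :=
  memLp_finsetSum _ fun ν _ => (memLp_top_const (v ν)).indicator (hA.const_smul _)

variable [MeasurableConstSMul N α] [SMulInvariantMeasure N α μ]

lemma ae_forall_smul [Countable N] {p : α → Prop} (hp : ∀ᵐ ξ ∂μ, p ξ) :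
    ∀ᵐ ξ ∂μ, ∀ ν : N, p (ν • ξ) :=
  ae_all_iff.mpr fun ν => (measurePreserving_smul ν μ).quasiMeasurePreserving.ae hp

lemma ae_of_ae_restrict_forall_smul [Countable N] (hΩ : IsFundamentalDomain N Ω μ)
    {p : α → Prop} (hp : ∀ᵐ ξ ∂μ.restrict Ω, ∀ ν : N, p (ν • ξ)) : ∀ᵐ ξ ∂μ, p ξ := by
  filter_upwards [hΩ.ae_covers,
    ae_forall_smul (N := N) ((ae_restrict_iff'₀ hΩ.nullMeasurableSet).mp hp)] with ξ ⟨ν, hν⟩ hξ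
  simpa using hξ ν hν ν⁻¹

variable [Fintype N]

lemma enorm_sq_eq_sum_setLIntegral (hΩ : IsFundamentalDomain N Ω μ) (f : Lp ℂ 2 μ) :
    ‖f‖ₑ ^ 2 = ∑ ν : N, ∫⁻ ξ in Ω, ‖f (ν • ξ)‖ₑ ^ 2 ∂μ := by
  rw [enorm_sq_eq_lintegral, hΩ.lintegral_eq_tsum'', tsum_fintype]

variable (N) in
/-- The average of a function over the orbits of `N`. -/
def average : Lp ℂ 2 μ →L[ℂ] Lp ℂ 2 μ :=
  (Nat.card N : ℂ)⁻¹ • ∑ ν : N,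
    (Lp.compMeasurePreservingₗᵢ ℂ (ν • ·) (measurePreserving_smul ν μ)).toContinuousLinearMap

lemma coeFn_average (f : Lp ℂ 2 μ) :
    average N f =ᵐ[μ] fun ξ => (Nat.card N : ℂ)⁻¹ * ∑ ν : N, f (ν • ξ) := by
  have average_apply : average N f = (Nat.card N : ℂ)⁻¹ •
      ∑ ν : N, Lp.compMeasurePreserving (ν • ·) (measurePreserving_smul ν μ) f := by
    simp only [average, _root_.smul_apply, _root_.sum_apply,
      LinearIsometry.coe_toContinuousLinearMap]
    rfl
  rw [average_apply]
  filter_upwards [Lp.coeFn_smul (Nat.card N : ℂ)⁻¹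
      (∑ ν : N, Lp.compMeasurePreserving (ν • ·) (measurePreserving_smul ν μ) f),
    Lp.coeFn_finsetSum Finset.univ
      fun ν : N => Lp.compMeasurePreserving (ν • ·) (measurePreserving_smul ν μ) f,
    ae_all_iff.mpr fun ν : N => Lp.coeFn_compMeasurePreserving f (measurePreserving_smul ν μ)]
    with ξ h_smul h_sum h_comp
  rw [h_smul, Pi.smul_apply, h_sum, Finset.sum_apply, smul_eq_mul]
  simp only [h_comp, Function.comp_apply]

lemma card_mul_enorm_sq_average (hΩ : IsFundamentalDomain N Ω μ) (f : Lp ℂ 2 μ) :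
    (Nat.card N : ℝ≥0∞) * ‖average N f‖ₑ ^ 2 = ∫⁻ ξ in Ω, ‖∑ ν : N, f (ν • ξ)‖ₑ ^ 2 ∂μ := by
  obtain ⟨r, hr⟩ : ∃ r : ℝ≥0∞, r = (Nat.card N : ℝ≥0∞) := ⟨_, rfl⟩
  have hr0 : r ≠ 0 := hr ▸ Nat.cast_ne_zero.mpr Nat.card_pos.ne'
  have hr_top : r ≠ ∞ := hr ▸ ENNReal.natCast_ne_top _
  have hr_enorm : ‖(Nat.card N : ℂ)⁻¹‖ₑ = r⁻¹ := by
    rw [enorm_inv (Nat.cast_ne_zero.mpr Nat.card_pos.ne'), ← ofReal_norm, Complex.norm_natCast,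
      ENNReal.ofReal_natCast, hr]
  have average_smul : ∀ᵐ ξ ∂μ, ∀ κ : N,
      ‖average N f (κ • ξ)‖ₑ ^ 2 = r⁻¹ ^ 2 * ‖∑ ν : N, f (ν • ξ)‖ₑ ^ 2 := by
    filter_upwards [ae_forall_smul (N := N) (coeFn_average (N := N) f)] with ξ hξ κ
    rw [hξ κ, enorm_mul, mul_pow, hr_enorm, ← Equiv.sum_comp (Equiv.mulRight κ) fun ν => f (ν • ξ)]
    simp only [Equiv.coe_mulRight, mul_smul]
  have setLIntegral_eq : ∀ κ : N, ∫⁻ ξ in Ω, ‖average N f (κ • ξ)‖ₑ ^ 2 ∂μ =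
      r⁻¹ ^ 2 * ∫⁻ ξ in Ω, ‖∑ ν : N, f (ν • ξ)‖ₑ ^ 2 ∂μ := fun κ => by
    rw [← lintegral_const_mul' _ _ (ENNReal.pow_ne_top (ENNReal.inv_ne_top.mpr hr0))]
    exact lintegral_congr_ae (ae_restrict_of_ae (average_smul.mono fun ξ h => h κ))
  simp only [enorm_sq_eq_sum_setLIntegral hΩ, setLIntegral_eq, Finset.sum_const, Finset.card_univ,
    ← Nat.card_eq_fintype_card, nsmul_eq_mul, ← hr]
  rw [← mul_assoc, ← mul_assoc, ← sq, ← mul_pow, ENNReal.mul_inv_cancel hr0 hr_top, one_pow,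
    one_mul]

lemma enorm_sq_eq_of_ae_eq_orbitStep (hΩ : IsFundamentalDomain N Ω μ) {v : N → ℂ} {A : Set α}
    (hA : MeasurableSet A) (hAΩ : A ⊆ Ω) {f : Lp ℂ 2 μ} (hf : f =ᵐ[μ] orbitStep v A) :
    ‖f‖ₑ ^ 2 = (∑ ν, ‖v ν‖ₑ ^ 2) * μ A := by
  rw [enorm_sq_eq_sum_setLIntegral hΩ, Finset.sum_mul]
  refine Finset.sum_congr rfl fun ν _ => ?_
  have fibre_eq : (fun ξ => ‖f (ν • ξ)‖ₑ ^ 2) =ᵐ[μ.restrict Ω]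
      A.indicator fun _ => ‖v ν‖ₑ ^ 2 := by
    filter_upwards [ae_restrict_of_ae (ae_forall_smul (N := N) hf), ae_orbitStep_smul hΩ v hAΩ]
      with ξ h_smul h_step
    rw [h_smul, h_step]
    by_cases h : ξ ∈ A <;> simp [h]
  rw [lintegral_congr_ae fibre_eq, lintegral_indicator_const hA, Measure.restrict_apply hA,
    Set.inter_eq_self_of_subset_left hAΩ]

lemma card_mul_enorm_sq_average_of_ae_eq_mul_orbitStep (hΩ : IsFundamentalDomain N Ω μ)
    {v : N → ℂ} {A : Set α} (hA : MeasurableSet A) (hAΩ : A ⊆ Ω) {g : α → ℂ} {f : Lp ℂ 2 μ}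
    (hf : f =ᵐ[μ] fun ξ => g ξ * orbitStep v A ξ) :
    (Nat.card N : ℝ≥0∞) * ‖average N f‖ₑ ^ 2 =
      ∫⁻ ξ in A, ‖∑ ν : N, g (ν • ξ) * v ν‖ₑ ^ 2 ∂μ := by
  have fibre_eq : (fun ξ => ‖∑ ν : N, f (ν • ξ)‖ₑ ^ 2) =ᵐ[μ.restrict Ω]
      A.indicator fun ξ => ‖∑ ν : N, g (ν • ξ) * v ν‖ₑ ^ 2 := by
    filter_upwards [ae_restrict_of_ae (ae_forall_smul (N := N) hf), ae_orbitStep_smul hΩ v hAΩ]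
      with ξ h_smul h_step
    simp only [h_smul, h_step]
    by_cases h : ξ ∈ A <;> simp [h]
  rw [card_mul_enorm_sq_average hΩ, lintegral_congr_ae fibre_eq, lintegral_indicator hA,
    Measure.restrict_restrict hA, Set.inter_eq_self_of_subset_left hAΩ]

end FiniteGroupAction

section OrbitMatrix

variable {m N α : Type*} [Group N] [MulAction N α]

/-- The matrix whose columns are the values of the family `Γ` along the orbit of `ξ`. -/
def orbitMatrix (N : Type*) [Group N] [MulAction N α] (Γ : m → α → ℂ) (ξ : α) : Matrix m N ℂ :=
  Matrix.of fun j ν => Γ j (ν • ξ)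

lemma orbitMatrix_smul_mulVec [Fintype N] (Γ : m → α → ℂ) (ξ : α) (κ : N) (v : N → ℂ) :
    orbitMatrix N Γ (κ • ξ) *ᵥ v = orbitMatrix N Γ ξ *ᵥ fun ν => v (ν * κ⁻¹) := by
  ext j
  simp only [orbitMatrix, Matrix.mulVec, dotProduct, Matrix.of_apply]
  rw [← Equiv.sum_comp (Equiv.mulRight κ) fun ν => Γ j (ν • ξ) * v (ν * κ⁻¹)]
  simp only [Equiv.coe_mulRight, mul_smul, mul_inv_cancel_right]

variable [MeasurableSpace α] {μ : Measure α} {Ω : Set α} [MeasurableConstSMul N α]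
  [SMulInvariantMeasure N α μ] {Γ : m → α → ℂ}

lemma aestronglyMeasurable_orbitMatrix_apply {p : ℝ≥0∞} (hΓ : ∀ j, MemLp (Γ j) p μ) (j : m)
    (ν : N) : AEStronglyMeasurable (fun ξ => orbitMatrix N Γ ξ j ν) μ :=
  ((hΓ j).comp_measurePreserving (measurePreserving_smul ν μ)).aestronglyMeasurable

section TestFunctions

variable [Fintype N] [IsFiniteMeasure μ]

lemma ae_card_mul_sum_enorm_sq_le [Fintype m] (hΩ : IsFundamentalDomain N Ω μ)
    (hΩ_meas : MeasurableSet Ω) (hΓ : ∀ j, MemLp (Γ j) ∞ μ) {c : ℝ≥0∞} (hc : c ≠ ∞)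
    (hle : ∀ f : Lp ℂ 2 μ, ‖f‖ₑ ^ 2 ≤ c * ∑ j, ‖average N (mulOp (hΓ j) f)‖ₑ ^ 2) (v : N → ℂ) :
    ∀ᵐ ξ ∂μ.restrict Ω,
      Nat.card N * ∑ ν, ‖v ν‖ₑ ^ 2 ≤ c * ∑ j, ‖(orbitMatrix N Γ ξ *ᵥ v) j‖ₑ ^ 2 := by
  have measurable_mulVec : ∀ j, AEMeasurable (fun ξ => ‖(orbitMatrix N Γ ξ *ᵥ v) j‖ₑ ^ 2) μ :=
    fun j => ((Finset.aemeasurable_fun_sum _ fun ν _ =>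
      (aestronglyMeasurable_orbitMatrix_apply hΓ j ν).aemeasurable.mul_const _).enorm).pow_const 2
  refine ae_le_of_forall_setLIntegral_le_of_sigmaFinite measurable_const fun A hA _ => ?_
  rw [Measure.restrict_restrict hA]
  have hAΩ : MeasurableSet (A ∩ Ω) := hA.inter hΩ_meas
  have hstep := (memLp_orbitStep (μ := μ) v hAΩ).mono_exponent le_top (p := 2)
  have norm_step := enorm_sq_eq_of_ae_eq_orbitStep hΩ hAΩ Set.inter_subset_right hstep.coeFn_toLp
  have average_step : ∀ j, Nat.card N * ‖average N (mulOp (hΓ j) hstep.toLp)‖ₑ ^ 2 =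
      ∫⁻ ξ in A ∩ Ω, ‖(orbitMatrix N Γ ξ *ᵥ v) j‖ₑ ^ 2 ∂μ := fun j =>
    card_mul_enorm_sq_average_of_ae_eq_mul_orbitStep hΩ hAΩ Set.inter_subset_right <| by
      filter_upwards [coeFn_mulOp (hΓ j) hstep.toLp, hstep.coeFn_toLp] with ξ h_mul h_toLp
      rw [h_mul, h_toLp]
  calc ∫⁻ _ in A ∩ Ω, Nat.card N * ∑ ν, ‖v ν‖ₑ ^ 2 ∂μ
      = Nat.card N * ‖hstep.toLp‖ₑ ^ 2 := by rw [setLIntegral_const, mul_assoc, norm_step]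
    _ ≤ Nat.card N * (c * ∑ j, ‖average N (mulOp (hΓ j) hstep.toLp)‖ₑ ^ 2) := by
        gcongr; exact hle _
    _ = c * ∑ j, Nat.card N * ‖average N (mulOp (hΓ j) hstep.toLp)‖ₑ ^ 2 := by
        rw [mul_left_comm, Finset.mul_sum]
    _ = ∫⁻ ξ in A ∩ Ω, c * ∑ j, ‖(orbitMatrix N Γ ξ *ᵥ v) j‖ₑ ^ 2 ∂μ := by
        rw [lintegral_const_mul' _ _ hc,
          lintegral_finsetSum' _ fun j _ => (measurable_mulVec j).restrict]
        simp only [average_step]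

lemma ae_enorm_sq_le_of_average_mulOp_le (hΩ : IsFundamentalDomain N Ω μ)
    (hΩ_meas : MeasurableSet Ω) {f : Lp ℂ 2 μ} {B : ℝ≥0∞}
    (hle : ∀ (g : α → ℂ) (hg : MemLp g ∞ μ),
      ‖average N (mulOp hg f)‖ₑ ^ 2 ≤ B * ‖(hg.mono_exponent le_top : MemLp g 2 μ).toLp‖ₑ ^ 2) :
    ∀ᵐ ξ ∂μ, ‖f ξ‖ₑ ^ 2 ≤ Nat.card N * B := by
  classical
  refine ae_of_ae_restrict_forall_smul hΩ (ae_all_iff.mpr fun ν => ?_)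
  refine ae_le_of_forall_setLIntegral_le_of_sigmaFinite
    (((Lp.stronglyMeasurable f).measurable.comp (measurable_const_smul ν)).enorm.pow_const 2)
    fun A hA _ => ?_
  rw [Measure.restrict_restrict hA]
  have hAΩ : MeasurableSet (A ∩ Ω) := hA.inter hΩ_meas
  have hstep := memLp_orbitStep (μ := μ) (Pi.single ν 1 : N → ℂ) hAΩ
  have norm_step := enorm_sq_eq_of_ae_eq_orbitStep hΩ hAΩ Set.inter_subset_right
    (hstep.mono_exponent le_top : MemLp _ 2 μ).coeFn_toLp
  have average_step := card_mul_enorm_sq_average_of_ae_eq_mul_orbitStep hΩ hAΩ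
    Set.inter_subset_right (f := mulOp hstep f) (g := f) <| by
      filter_upwards [coeFn_mulOp hstep f] with ξ h_mul
      rw [h_mul, mul_comm]
  calc ∫⁻ ξ in A ∩ Ω, ‖f (ν • ξ)‖ₑ ^ 2 ∂μ
      = Nat.card N * ‖average N (mulOp hstep f)‖ₑ ^ 2 := by
        simp only [average_step, Pi.single_apply, mul_ite, mul_one, mul_zero, Finset.sum_ite_eq',
          Finset.mem_univ, if_true]
    _ ≤ Nat.card N * (B * ‖(hstep.mono_exponent le_top : MemLp _ 2 μ).toLp‖ₑ ^ 2) := by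
        gcongr
        exact hle _ _
    _ = ∫⁻ _ in A ∩ Ω, Nat.card N * B ∂μ := by
        rw [norm_step, setLIntegral_const, Finset.sum_eq_single ν
          (fun ν' _ hne => by simp [hne]) (by simp), Pi.single_eq_same, enorm_one, one_pow,
          one_mul, mul_assoc]

end TestFunctions

end OrbitMatrix

section SmallestEigenvalue

variable {m n : Type*} [Fintype m] [Fintype n]

lemma sum_norm_sq_eq_star_dotProduct (w : m → ℂ) :
    ((∑ i, ‖w i‖ ^ 2 : ℝ) : ℂ) = star w ⬝ᵥ w := by
  simp only [dotProduct, Complex.ofReal_sum, Pi.star_apply, RCLike.star_def, Complex.conj_mul',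
    Complex.ofReal_pow]

lemma sum_norm_sq_mulVec (A : Matrix m n ℂ) (v : n → ℂ) :
    ((∑ i, ‖(A *ᵥ v) i‖ ^ 2 : ℝ) : ℂ) = star v ⬝ᵥ ((Aᴴ * A) *ᵥ v) := by
  rw [sum_norm_sq_eq_star_dotProduct, Matrix.star_mulVec, ← Matrix.mulVec_mulVec,
    Matrix.dotProduct_mulVec (star v)]

open scoped MatrixOrder ComplexOrder in
lemma le_lambdaMin_iff [Nonempty n] {A : Matrix m n ℂ} {δ : ℝ} :
    δ ≤ lambdaMin A ↔ ∀ v : n → ℂ, δ * ∑ j, ‖v j‖ ^ 2 ≤ ∑ i, ‖(A *ᵥ v) i‖ ^ 2 := by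
  classical
  have hA := Matrix.isHermitian_conjTranspose_mul_self A
  have quadratic_form (v : n → ℂ) : star v ⬝ᵥ ((Aᴴ * A - algebraMap ℝ _ δ) *ᵥ v) =
      ((∑ i, ‖(A *ᵥ v) i‖ ^ 2 - δ * ∑ j, ‖v j‖ ^ 2 : ℝ) : ℂ) := by
    rw [Matrix.sub_mulVec, dotProduct_sub, ← sum_norm_sq_mulVec, Algebra.algebraMap_eq_smul_one,
      Matrix.smul_mulVec, Matrix.one_mulVec, dotProduct_smul, ← sum_norm_sq_eq_star_dotProduct]
    simp
  calc δ ≤ lambdaMin A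
      ↔ ∀ x ∈ spectrum ℝ (Aᴴ * A), δ ≤ x := by
        rw [hA.spectrum_real_eq_range_eigenvalues, Set.forall_mem_range]
        exact le_ciInf_iff (Set.finite_range _).bddBelow
    _ ↔ (Aᴴ * A - algebraMap ℝ _ δ).PosSemidef :=
        (algebraMap_le_iff_le_spectrum (ha := hA.isSelfAdjoint)).symm
    _ ↔ ∀ v : n → ℂ, δ * ∑ j, ‖v j‖ ^ 2 ≤ ∑ i, ‖(A *ᵥ v) i‖ ^ 2 := by
        rw [Matrix.posSemidef_iff_dotProduct_mulVec, and_iff_right]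
        · simp only [quadratic_form, Complex.zero_le_real, sub_nonneg]
        · exact hA.sub (IsSelfAdjoint.algebraMap _ (IsSelfAdjoint.all δ)).isHermitian

/-- The Moore-Penrose inverse `(Aᴴ A)⁻¹ Aᴴ` of a matrix with linearly independent columns. -/
def pinv [DecidableEq n] (A : Matrix m n ℂ) : Matrix n m ℂ := (Aᴴ * A)⁻¹ * Aᴴ

variable [DecidableEq n]

open scoped ComplexOrder in
lemma isUnit_det_conjTranspose_mul_self {A : Matrix m n ℂ} {δ : ℝ} (hδ : 0 < δ)
    (hA : ∀ v : n → ℂ, δ * ∑ j, ‖v j‖ ^ 2 ≤ ∑ i, ‖(A *ᵥ v) i‖ ^ 2) : IsUnit (Aᴴ * A).det := by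
  have hinj : Function.Injective A.mulVec := by
    rw [← Matrix.coe_mulVecLin, injective_iff_map_eq_zero]
    intro v hv
    have sum_le : δ * ∑ j, ‖v j‖ ^ 2 ≤ 0 := by
      simpa [show A *ᵥ v = 0 from hv] using hA v
    have sum_eq : ∑ j, ‖v j‖ ^ 2 = 0 :=
      (nonpos_of_mul_nonpos_right sum_le hδ).antisymm (by positivity)
    ext j
    simpa using (Finset.sum_eq_zero_iff_of_nonneg fun j _ => by positivity).mp sum_eq j
  exact (Matrix.isUnit_iff_isUnit_det _).mp (Matrix.PosDef.conjTranspose_mul_self A hinj).isUnit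

lemma pinv_mul_self {A : Matrix m n ℂ} (hA : IsUnit (Aᴴ * A).det) : pinv A * A = 1 := by
  rw [pinv, Matrix.mul_assoc, Matrix.nonsing_inv_mul _ hA]

lemma pinv_mul_conjTranspose_pinv {A : Matrix m n ℂ} (hA : IsUnit (Aᴴ * A).det) :
    pinv A * (pinv A)ᴴ = (Aᴴ * A)⁻¹ := by
  rw [pinv, Matrix.conjTranspose_mul, Matrix.conjTranspose_conjTranspose,
    Matrix.conjTranspose_nonsing_inv, (Matrix.isHermitian_conjTranspose_mul_self A).eq,
    Matrix.mul_assoc, ← Matrix.mul_assoc Aᴴ, Matrix.mul_nonsing_inv _ hA, Matrix.mul_one]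

lemma sum_norm_sq_pinv_le {A : Matrix m n ℂ} {δ : ℝ} (hδ : 0 < δ)
    (hA : ∀ v : n → ℂ, δ * ∑ j, ‖v j‖ ^ 2 ≤ ∑ i, ‖(A *ᵥ v) i‖ ^ 2) (k : n) :
    ∑ i, ‖pinv A k i‖ ^ 2 ≤ δ⁻¹ := by
  have hdet := isUnit_det_conjTranspose_mul_self hδ hA
  -- `A u` is the conjugate of the `k`-th row of `pinv A`, and its squared norm is `u k`.
  set u : n → ℂ := fun j => (Aᴴ * A)⁻¹ j k
  have norm_row : ∀ i, ‖(A *ᵥ u) i‖ = ‖pinv A k i‖ := fun i => by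
    rw [← norm_star (pinv A k i), ← Matrix.conjTranspose_apply, pinv, Matrix.conjTranspose_mul,
      Matrix.conjTranspose_conjTranspose, Matrix.conjTranspose_nonsing_inv,
      (Matrix.isHermitian_conjTranspose_mul_self A).eq]
    rfl
  set S := ∑ i, ‖pinv A k i‖ ^ 2 with hS
  have hS_nonneg : 0 ≤ S := by positivity
  have norm_u : ‖u k‖ = S := by
    have u_apply : u k = (S : ℂ) := calc
      u k = (pinv A * (pinv A)ᴴ) k k := by rw [pinv_mul_conjTranspose_pinv hdet]
      _ = (S : ℂ) := by
        simp only [Matrix.mul_apply, hS, Complex.ofReal_sum, Matrix.conjTranspose_apply,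
          RCLike.star_def, Complex.mul_conj', Complex.ofReal_pow]
    rw [u_apply, Complex.norm_real, Real.norm_of_nonneg hS_nonneg]
  have hS_sq : δ * S ^ 2 ≤ S := calc
    δ * S ^ 2 ≤ δ * ∑ j, ‖u j‖ ^ 2 := by
        rw [← norm_u]
        gcongr
        exact Finset.single_le_sum (f := fun j => ‖u j‖ ^ 2) (fun j _ => by positivity)
          (Finset.mem_univ k)
    _ ≤ ∑ i, ‖(A *ᵥ u) i‖ ^ 2 := hA u
    _ = S := by simp only [norm_row, hS]
  rw [← one_div, le_div_iff₀ hδ]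
  by_contra! hlt
  have hS_pos : 0 < S := pos_of_mul_pos_left (one_pos.trans hlt) hδ.le
  nlinarith [mul_lt_mul_of_pos_right hlt hS_pos]

lemma measurable_pinv_apply (k : n) (i : m) :
    Measurable fun A : m → n → ℂ => pinv (Matrix.of A) k i := by
  have continuous_conjTranspose : Continuous fun A : m → n → ℂ => (Matrix.of A)ᴴ :=
    Continuous.matrix_conjTranspose continuous_id
  have continuous_gram : Continuous fun A : m → n → ℂ => (Matrix.of A)ᴴ * Matrix.of A :=
    continuous_conjTranspose.matrix_mul continuous_id
  have measurable_inv (j : n) :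
      Measurable fun A : m → n → ℂ => ((Matrix.of A)ᴴ * Matrix.of A)⁻¹ k j := by
    simp only [Matrix.inv_def, Ring.inverse_eq_inv', Matrix.smul_apply, smul_eq_mul]
    exact continuous_gram.matrix_det.measurable.inv.mul
      (continuous_gram.matrix_adjugate.matrix_elem k j).measurable
  simp only [pinv, Matrix.mul_apply]
  exact Finset.measurable_fun_sum _ fun j _ =>
    (measurable_inv j).mul (continuous_conjTranspose.matrix_elem j i).measurable

end SmallestEigenvalue

section LeftInverse

variable {m N α : Type*} [Group N] [MulAction N α] [MeasurableSpace α] {μ : Measure α} {Ω : Set α}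
  [MeasurableConstSMul N α] [SMulInvariantMeasure N α μ] [Fintype N] {Γ F : m → α → ℂ}

lemma memLp_top_of_average_mulOp_le [IsFiniteMeasure μ] (hΩ : IsFundamentalDomain N Ω μ)
    (hΩ_meas : MeasurableSet Ω) {f : Lp ℂ 2 μ} {B : ℝ} (hB : 0 ≤ B)
    (hle : ∀ (g : α → ℂ) (hg : MemLp g ∞ μ),
      ‖average N (mulOp hg f)‖ ^ 2 ≤ B * ‖(hg.mono_exponent le_top : MemLp g 2 μ).toLp‖ ^ 2) :
    MemLp f ∞ μ := by
  have enorm_le := ae_enorm_sq_le_of_average_mulOp_le (B := ENNReal.ofReal B) hΩ hΩ_meas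
    fun g hg => by
      rw [enorm_sq_eq_ofReal, enorm_sq_eq_ofReal, ← ENNReal.ofReal_mul hB]
      exact ENNReal.ofReal_le_ofReal (hle g hg)
  refine memLp_top_of_bound (Lp.aestronglyMeasurable f) √(Nat.card N * B) ?_
  filter_upwards [enorm_le] with ξ hξ
  rw [enorm_sq_eq_ofReal, ← ENNReal.ofReal_natCast, ← ENNReal.ofReal_mul (Nat.cast_nonneg _)] at hξ
  exact Real.le_sqrt_of_sq_le ((ENNReal.ofReal_le_ofReal_iff (by positivity)).mp hξ)

variable [Fintype m]

lemma ae_forall_card_mul_sum_norm_sq_le [IsFiniteMeasure μ] (hΩ : IsFundamentalDomain N Ω μ)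
    (hΩ_meas : MeasurableSet Ω) (hΓ : ∀ j, MemLp (Γ j) ∞ μ) {c : ℝ} (hc : 0 ≤ c)
    (hle : ∀ f : Lp ℂ 2 μ, ‖f‖ ^ 2 ≤ c * ∑ j, ‖average N (mulOp (hΓ j) f)‖ ^ 2) :
    ∀ᵐ ξ ∂μ.restrict Ω, ∀ v : N → ℂ,
      Nat.card N * ∑ ν, ‖v ν‖ ^ 2 ≤ c * ∑ j, ‖(orbitMatrix N Γ ξ *ᵥ v) j‖ ^ 2 := by
  have ae_dense := ae_all_iff.mpr fun n => ae_card_mul_sum_enorm_sq_le (c := ENNReal.ofReal c) hΩ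
    hΩ_meas hΓ ENNReal.ofReal_ne_top (fun f => by
      rw [enorm_sq_eq_ofReal, sum_enorm_sq_eq_ofReal, ← ENNReal.ofReal_mul hc]
      exact ENNReal.ofReal_le_ofReal (hle f)) (TopologicalSpace.denseSeq (N → ℂ) n)
  filter_upwards [ae_dense] with ξ hξ v
  have isClosed_bound : IsClosed {v : N → ℂ |
      Nat.card N * ∑ ν, ‖v ν‖ ^ 2 ≤ c * ∑ j, ‖(orbitMatrix N Γ ξ *ᵥ v) j‖ ^ 2} := by
    have : Continuous fun v : N → ℂ => orbitMatrix N Γ ξ *ᵥ v :=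
      continuous_const.matrix_mulVec continuous_id
    exact isClosed_le (by fun_prop) (by fun_prop)
  refine isClosed_bound.closure_subset_iff.mpr (Set.range_subset_iff.mpr fun n => ?_)
    (TopologicalSpace.denseRange_denseSeq _ v)
  have := hξ n
  rw [sum_enorm_sq_eq_ofReal, sum_enorm_sq_eq_ofReal, ← ENNReal.ofReal_mul hc,
    ← ENNReal.ofReal_natCast, ← ENNReal.ofReal_mul (Nat.cast_nonneg _)] at this
  exact (ENNReal.ofReal_le_ofReal_iff (by positivity)).mp this

lemma exists_vecMul_orbitMatrix_eq_single [DecidableEq N] (hΩ : IsFundamentalDomain N Ω μ)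
    (hΓ : ∀ j, MemLp (Γ j) ∞ μ) {δ : ℝ} (hδ : 0 < δ)
    (hle : ∀ᵐ ξ ∂μ.restrict Ω, ∀ v : N → ℂ,
      δ * ∑ ν, ‖v ν‖ ^ 2 ≤ ∑ j, ‖(orbitMatrix N Γ ξ *ᵥ v) j‖ ^ 2) :
    ∃ F : m → α → ℂ, (∀ j, MemLp (F j) ∞ μ) ∧
      ∀ᵐ ξ ∂μ, (fun j => F j ξ) ᵥ* orbitMatrix N Γ ξ = Pi.single 1 1 := by
  have bound : ∀ᵐ ξ ∂μ, ∀ v : N → ℂ,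
      δ * ∑ ν, ‖v ν‖ ^ 2 ≤ ∑ j, ‖(orbitMatrix N Γ ξ *ᵥ v) j‖ ^ 2 := by
    refine ae_of_ae_restrict_forall_smul hΩ ?_
    filter_upwards [hle] with ξ hξ κ v
    rw [orbitMatrix_smul_mulVec, ← Equiv.sum_comp (Equiv.mulRight κ⁻¹) fun ν => ‖v ν‖ ^ 2]
    exact hξ _
  refine ⟨fun j ξ => pinv (orbitMatrix N Γ ξ) 1 j, fun j => memLp_top_of_bound ?_ √δ⁻¹ ?_, ?_⟩
  · refine ((measurable_pinv_apply 1 j).comp_aemeasurable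
      (f := fun ξ i (ν : N) => orbitMatrix N Γ ξ i ν) ?_).aestronglyMeasurable
    exact aemeasurable_pi_lambda _ fun i => aemeasurable_pi_lambda _ fun ν =>
      (aestronglyMeasurable_orbitMatrix_apply hΓ i ν).aemeasurable
  · filter_upwards [bound] with ξ hξ
    exact Real.le_sqrt_of_sq_le <|
      (Finset.single_le_sum (f := fun i => ‖pinv (orbitMatrix N Γ ξ) 1 i‖ ^ 2)
        (fun i _ => by positivity) (Finset.mem_univ j)).trans (sum_norm_sq_pinv_le hδ hξ 1)
  · filter_upwards [bound] with ξ hξ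
    calc (fun j => pinv (orbitMatrix N Γ ξ) 1 j) ᵥ* orbitMatrix N Γ ξ
        = (pinv (orbitMatrix N Γ ξ) * orbitMatrix N Γ ξ) 1 := rfl
      _ = (1 : Matrix N N ℂ) 1 := by
          rw [pinv_mul_self (isUnit_det_conjTranspose_mul_self hδ hξ)]
      _ = Pi.single 1 1 := by
          ext ν
          rw [Matrix.one_eq_pi_single]

variable (N) in
/-- The operator recovering `f` from the averages of the products `Γ j * f`, with the `F j` as
synthesis functions. -/
def reconstruction (hF : ∀ j, MemLp (F j) ∞ μ) (hΓ : ∀ j, MemLp (Γ j) ∞ μ) :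
    Lp ℂ 2 μ →L[ℂ] Lp ℂ 2 μ :=
  (Nat.card N : ℂ) • ∑ j, mulOp (hF j) ∘L average N ∘L mulOp (hΓ j)

lemma coeFn_reconstruction (hF : ∀ j, MemLp (F j) ∞ μ) (hΓ : ∀ j, MemLp (Γ j) ∞ μ)
    (f : Lp ℂ 2 μ) : reconstruction N hF hΓ f =ᵐ[μ] fun ξ =>
      ((fun j => F j ξ) ᵥ* orbitMatrix N Γ ξ) ⬝ᵥ fun ν => f (ν • ξ) := by
  have reconstruction_apply : reconstruction N hF hΓ f =
      (Nat.card N : ℂ) • ∑ j, mulOp (hF j) (average N (mulOp (hΓ j) f)) := by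
    simp only [reconstruction, _root_.smul_apply, _root_.sum_apply, ContinuousLinearMap.comp_apply]
  rw [reconstruction_apply]
  filter_upwards [Lp.coeFn_smul (Nat.card N : ℂ)
      (∑ j, mulOp (hF j) (average N (mulOp (hΓ j) f))),
    Lp.coeFn_finsetSum Finset.univ fun j => mulOp (hF j) (average N (mulOp (hΓ j) f)),
    ae_all_iff.mpr fun j => coeFn_mulOp (hF j) (average N (mulOp (hΓ j) f)),
    ae_all_iff.mpr fun j => coeFn_average (N := N) (mulOp (hΓ j) f),
    ae_all_iff.mpr fun j => ae_forall_smul (N := N) (coeFn_mulOp (hΓ j) f)]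
    with ξ h_smul h_sum h_F h_average h_Γ
  have hcard : (Nat.card N : ℂ) ≠ 0 := Nat.cast_ne_zero.mpr Nat.card_pos.ne'
  rw [h_smul, Pi.smul_apply, h_sum, Finset.sum_apply, smul_eq_mul, ← Matrix.dotProduct_mulVec,
    dotProduct, Finset.mul_sum]
  refine Finset.sum_congr rfl fun j _ => ?_
  rw [h_F, h_average, mul_left_comm, mul_inv_cancel_left₀ hcard]
  simp only [h_Γ]
  rfl

lemma reconstruction_eq_self_iff [IsFiniteMeasure μ] [DecidableEq N]
    (hΩ : IsFundamentalDomain N Ω μ) (hΩ_meas : MeasurableSet Ω) (hF : ∀ j, MemLp (F j) ∞ μ)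
    (hΓ : ∀ j, MemLp (Γ j) ∞ μ) :
    (∀ f : Lp ℂ 2 μ, reconstruction N hF hΓ f = f) ↔
      ∀ᵐ ξ ∂μ, (fun j => F j ξ) ᵥ* orbitMatrix N Γ ξ = Pi.single 1 1 := by
  constructor
  · intro hrec
    -- Test the identity on the indicator functions of the translates of `Ω`.
    have hmem (κ : N) : MemLp ((κ • Ω).indicator fun _ => (1 : ℂ)) 2 μ :=
      (memLp_const 1).indicator (hΩ_meas.const_smul κ)
    filter_upwards [ae_exists_forall_mem_smul_iff hΩ,
      ae_all_iff.mpr fun κ => coeFn_reconstruction (N := N) hF hΓ (hmem κ).toLp,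
      ae_all_iff.mpr fun κ => (hmem κ).coeFn_toLp,
      ae_all_iff.mpr fun κ => ae_forall_smul (N := N) (hmem κ).coeFn_toLp]
      with ξ ⟨κ₀, hκ₀⟩ h_rec h_toLp h_smul
    ext κ
    have mem_iff (ν : N) : ν • ξ ∈ (κ * κ₀) • Ω ↔ ν = κ := by
      have smul_eq : (κ * κ₀) • Ω = ν • (ν⁻¹ * (κ * κ₀)) • Ω := by
        rw [smul_smul, mul_inv_cancel_left]
      rw [smul_eq, Set.smul_mem_smul_set_iff, hκ₀, ← mul_assoc, mul_eq_right, inv_mul_eq_one]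
    have := h_rec (κ * κ₀)
    rw [hrec, h_toLp] at this
    simp only [h_smul, Set.indicator, mem_iff, hκ₀, mul_eq_right, dotProduct, mul_ite, mul_one,
      mul_zero, Finset.sum_ite_eq', Finset.mem_univ, if_true] at this
    rw [Pi.single_apply, this]
  · intro hrow f
    refine Lp.ext ?_
    filter_upwards [coeFn_reconstruction (N := N) hF hΓ f, hrow] with ξ h_rec h_row
    rw [h_rec, h_row, single_one_dotProduct, one_smul]

end LeftInverse

section Characters

lemma exists_injective_ratCircle_toAdditive_circle :
    ∃ φ : AddCircle (1 : ℚ) →+ Additive Circle, Function.Injective φ := by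
  let expTwoPi : ℚ →+ Additive Circle :=
    Circle.expHom.comp ((AddMonoidHom.mulRight (2 * Real.pi)).comp (Rat.castHom ℝ : ℚ →+ ℝ))
  have zmultiples_eq_ker : AddSubgroup.zmultiples (1 : ℚ) = expTwoPi.ker := by
    ext q
    have mem_ker_iff : q ∈ expTwoPi.ker ↔ Circle.exp (q * (2 * Real.pi)) = 1 := Iff.rfl
    simp only [mem_ker_iff, Circle.exp_eq_one, AddSubgroup.mem_zmultiples_iff, zsmul_one,
      mul_eq_mul_right_iff, Real.two_pi_pos.ne', or_false, eq_comm (b := q)]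
    norm_cast
  exact ⟨_, (QuotientAddGroup.injective_lift_iff _ expTwoPi zmultiples_eq_ker.le).mpr
    zmultiples_eq_ker⟩

lemma exists_monoidHom_circle_ne_one {A : Type*} [AddCommGroup A] {x : A} (hx : x ≠ 0) :
    ∃ ψ : Multiplicative A →* Circle, ψ (Multiplicative.ofAdd x) ≠ 1 := by
  obtain ⟨c, hc⟩ := CharacterModule.exists_character_apply_ne_zero_of_ne_zero hx
  obtain ⟨φ, hφ⟩ := exists_injective_ratCircle_toAdditive_circle
  exact ⟨AddMonoidHom.toMultiplicativeLeft (φ.comp c), fun h => hc (hφ (h.trans φ.map_zero.symm))⟩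

variable {G : Type*} [AddCommGroup G] [TopologicalSpace G] {H : AddSubgroup G}

lemma chi_apply (h : H) (γ : Dual H) : chi H h γ = (γ (Multiplicative.ofAdd h) : ℂ) := rfl

lemma chi_zero (γ : Dual H) : chi H 0 γ = 1 := by
  rw [chi_apply, ofAdd_zero, map_one, Circle.coe_one]

lemma chi_add (h k : H) (γ : Dual H) : chi H (h + k) γ = chi H h γ * chi H k γ := by
  rw [chi_apply, ofAdd_add, map_mul, Circle.coe_mul]; rfl

lemma chi_neg (h : H) (γ : Dual H) : chi H (-h) γ = conj (chi H h γ) := by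
  rw [chi_apply, ofAdd_neg, map_inv, Circle.coe_inv_eq_conj]; rfl

lemma chi_mul (h : H) (γ ν : Dual H) : chi H h (γ * ν) = chi H h γ * chi H h ν :=
  Circle.coe_mul _ _

lemma norm_chi (h : H) (γ : Dual H) : ‖chi H h γ‖ = 1 := Circle.norm_coe _

section Annihilator

variable {M : AddSubgroup G} {hMH : M ≤ H}

lemma chi_of_mem_annihilator {ν : Dual H} (hν : ν ∈ annihilator hMH) {h : H} (hh : (h : G) ∈ M) :
    chi H h ν = 1 := by
  rw [chi_apply, show ν (Multiplicative.ofAdd h) = 1 from hν ⟨h, hh⟩, Circle.coe_one]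

lemma exists_mem_annihilator_chi_ne_one [DiscreteTopology H] (hMH : M ≤ H) {h : H}
    (hh : (h : G) ∉ M) : ∃ ν ∈ annihilator hMH, chi H h ν ≠ 1 := by
  have mk_ne_zero : (h : H ⧸ M.addSubgroupOf H) ≠ 0 := by
    rwa [Ne, QuotientAddGroup.eq_zero_iff, AddSubgroup.mem_addSubgroupOf]
  obtain ⟨ψ, hψ⟩ := exists_monoidHom_circle_ne_one mk_ne_zero
  let ν : Dual H :=
    (⟨ψ.comp (AddMonoidHom.toMultiplicative (QuotientAddGroup.mk' (M.addSubgroupOf H))),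
      continuous_of_discreteTopology⟩ : Multiplicative H →ₜ* Circle)
  have ν_apply : ∀ k : H, ν (Multiplicative.ofAdd k) =
    ψ (Multiplicative.ofAdd (k : H ⧸ M.addSubgroupOf H)) := fun k => rfl
  refine ⟨ν, fun m => ?_, fun h_eq => hψ (Circle.ext ?_)⟩
  · have mk_eq_zero : ((⟨m, hMH m.2⟩ : H) : H ⧸ M.addSubgroupOf H) = 0 :=
      (QuotientAddGroup.eq_zero_iff _).mpr (AddSubgroup.mem_addSubgroupOf.mpr m.2)
    rw [ν_apply, mk_eq_zero, ofAdd_zero, map_one]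
  · rw [← ν_apply, Circle.coe_one, ← h_eq, chi_apply]

lemma sum_chi_of_notMem [DiscreteTopology H] [Fintype (annihilator hMH)] {h : H}
    (hh : (h : G) ∉ M) : ∑ ν : annihilator hMH, chi H h ν = 0 := by
  obtain ⟨ν₀, hν₀, hne⟩ := exists_mem_annihilator_chi_ne_one hMH hh
  have sum_eq_mul_sum : ∑ ν : annihilator hMH, chi H h ν =
      (∑ ν : annihilator hMH, chi H h ν) * chi H h ν₀ := by
    rw [Finset.sum_mul, ← Equiv.sum_comp (Equiv.mulRight (⟨ν₀, hν₀⟩ : annihilator hMH))]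
    exact Finset.sum_congr rfl fun ν _ => chi_mul _ _ _
  by_contra hsum
  exact hne (mul_eq_left₀ hsum |>.mp sum_eq_mul_sum.symm)

end Annihilator

variable [DiscreteTopology H]

instance : (dualHaar H).IsMulLeftInvariant := by unfold dualHaar; infer_instance

instance : (dualHaar H).WeaklyRegular := by unfold dualHaar; infer_instance

lemma coeFn_chiL2 (h : H) : chiL2 H h =ᵐ[dualHaar H] chi H h := ContinuousMap.coeFn_toLp _ _

lemma integral_chi {h : H} (hh : h ≠ 0) : ∫ γ, chi H h γ ∂(dualHaar H) = 0 := by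
  obtain ⟨ν, -, hν⟩ := exists_mem_annihilator_chi_ne_one (bot_le : (⊥ : AddSubgroup G) ≤ H)
    (h := h) (by simpa using hh)
  have integral_translate := integral_mul_left_eq_self (μ := dualHaar H) (fun γ => chi H h γ) ν
  simp only [chi_mul, integral_const_mul] at integral_translate
  by_contra hint
  exact hν (mul_eq_right₀ hint |>.mp integral_translate)

lemma orthonormal_chiL2 : Orthonormal ℂ (chiL2 H) := by
  classical
  rw [orthonormal_iff_ite]
  intro i j
  rw [chiL2, chiL2, ContinuousMap.inner_toLp (dualHaar H) (chi H i) (chi H j)]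
  simp_rw [← chi_neg, ← chi_add]
  split_ifs with hij
  · simp [hij, chi_zero]
  · exact integral_chi fun h0 => hij (add_neg_eq_zero.mp h0).symm

variable (H) in
/-- The algebra of trigonometric polynomials on the dual group, generated by the characters. -/
def chiSubalgebra : StarSubalgebra ℂ C(Dual H, ℂ) where
  toSubalgebra := Algebra.adjoin ℂ (Set.range (chi H))
  star_mem' := by
    change Algebra.adjoin ℂ (Set.range (chi H)) ≤ star (Algebra.adjoin ℂ (Set.range (chi H)))
    refine Algebra.adjoin_le ?_
    rintro - ⟨h, rfl⟩
    exact Algebra.subset_adjoin ⟨-h, ContinuousMap.ext fun γ => chi_neg h γ⟩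

lemma toSubmodule_chiSubalgebra :
    Subalgebra.toSubmodule (chiSubalgebra H).toSubalgebra =
      Submodule.span ℂ (Set.range (chi H)) := by
  refine Algebra.adjoin_eq_span_of_subset _ (Set.Subset.trans ?_ Submodule.subset_span)
  intro x hx
  refine Submonoid.closure_induction (fun _ => id) ⟨0, ContinuousMap.ext chi_zero⟩ ?_ hx
  rintro - - - - ⟨h, rfl⟩ ⟨k, rfl⟩
  exact ⟨h + k, ContinuousMap.ext (chi_add h k)⟩

lemma separatesPoints_chiSubalgebra : (chiSubalgebra H).SeparatesPoints := by
  intro γ γ' hne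
  obtain ⟨h, hh⟩ : ∃ h : Multiplicative H, γ h ≠ γ' h := by
    by_contra! heq
    exact hne (PontryaginDual.ext heq)
  exact ⟨_, ⟨chi H h.toAdd, Algebra.subset_adjoin ⟨h.toAdd, rfl⟩, rfl⟩,
    fun heq => hh (Circle.ext heq)⟩

lemma topologicalClosure_span_chi :
    (Submodule.span ℂ (Set.range (chi H))).topologicalClosure = ⊤ := by
  rw [← toSubmodule_chiSubalgebra]
  exact congrArg (fun S => Subalgebra.toSubmodule (StarSubalgebra.toSubalgebra S))
    (ContinuousMap.starSubalgebra_topologicalClosure_eq_top_of_separatesPoints _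
      separatesPoints_chiSubalgebra)

lemma topologicalClosure_span_chiL2 :
    (Submodule.span ℂ (Set.range (chiL2 H))).topologicalClosure = ⊤ := by
  convert! (ContinuousMap.toLp_denseRange ℂ (dualHaar H) ℂ
    (p := 2) (by simp)).topologicalClosure_map_submodule (topologicalClosure_span_chi (H := H))
  rw [Submodule.map_span, ← Set.range_comp]
  rfl

variable (H) in
/-- The orthonormal basis of characters of the dual group. -/
def chiBasis : HilbertBasis H ℂ (Lp ℂ 2 (dualHaar H)) :=
  HilbertBasis.mk orthonormal_chiL2 topologicalClosure_span_chiL2.ge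

lemma coe_chiBasis : ⇑(chiBasis H) = chiL2 H := HilbertBasis.coe_mk _ _

lemma hasSum_inner_chiL2_smul (F : Lp ℂ 2 (dualHaar H)) :
    HasSum (fun h => ⟪chiL2 H h, F⟫_ℂ • chiL2 H h) F := by
  simpa only [HilbertBasis.repr_apply_apply, coe_chiBasis] using (chiBasis H).hasSum_repr F

lemma continuousLinearMap_ext_chiL2 {E : Type*} [NormedAddCommGroup E] [NormedSpace ℂ E]
    {S T : Lp ℂ 2 (dualHaar H) →L[ℂ] E} (hST : ∀ h, S (chiL2 H h) = T (chiL2 H h)) : S = T :=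
  ContinuousLinearMap.ext_on
    (Submodule.dense_iff_topologicalClosure_eq_top.mpr topologicalClosure_span_chiL2)
    (Set.forall_mem_range.mpr hST)

lemma memLp_chi (h : H) : MemLp (chi H h) ∞ (dualHaar H) :=
  memLp_top_of_bound (chi H h).continuous.aestronglyMeasurable 1
    (Filter.Eventually.of_forall fun γ => (norm_chi h γ).le)

lemma mulOp_chi_chiL2 (h k : H) : mulOp (memLp_chi h) (chiL2 H k) = chiL2 H (h + k) := by
  refine Lp.ext ?_
  filter_upwards [coeFn_mulOp (memLp_chi h) (chiL2 H k), coeFn_chiL2 k, coeFn_chiL2 (h + k)]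
    with ξ h_mul h_k h_add
  rw [h_mul, h_k, h_add, chi_add]

end Characters

section AnnihilatorAction

variable {G : Type*} [AddCommGroup G] [TopologicalSpace G] {H M : AddSubgroup G}
  [DiscreteTopology H] {hMH : M ≤ H}

lemma IsSection.isFundamentalDomain {Ω : Set (Dual H)} (hΩ : IsSection hMH Ω) :
    IsFundamentalDomain (annihilator hMH) Ω (dualHaar H) where
  nullMeasurableSet := hΩ.measurableSet.nullMeasurableSet
  ae_covers := Filter.Eventually.of_forall fun ξ => by
    obtain ⟨ν, hν⟩ := Set.mem_iUnion.mp (hΩ.iUnion_eq ▸ Set.mem_univ ξ :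
      ξ ∈ ⋃ ν : annihilator hMH, (ν : Dual H) • Ω)
    exact ⟨ν⁻¹, Set.mem_smul_set_iff_inv_smul_mem.mp hν⟩
  aedisjoint := fun ν ν' h => (hΩ.disjoint h).aedisjoint

variable [Fintype (annihilator hMH)]

lemma average_chiL2 (h : H) : average (annihilator hMH) (chiL2 H h) =
    ((Nat.card (annihilator hMH) : ℂ)⁻¹ * ∑ ν : annihilator hMH, chi H h ν) • chiL2 H h := by
  refine Lp.ext ?_
  filter_upwards [coeFn_average (N := annihilator hMH) (chiL2 H h),
    ae_forall_smul (N := annihilator hMH) (coeFn_chiL2 h), coeFn_chiL2 h, Lp.coeFn_smul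
      ((Nat.card (annihilator hMH) : ℂ)⁻¹ * ∑ ν : annihilator hMH, chi H h ν) (chiL2 H h)]
    with ξ h_average h_translate h_chi h_smul
  rw [h_average, h_smul, Pi.smul_apply, h_chi, smul_eq_mul, mul_assoc, Finset.sum_mul]
  simp only [h_translate]
  exact congrArg _ (Finset.sum_congr rfl fun ν _ => chi_mul h ν ξ)

lemma average_chiL2_of_mem {h : H} (hh : (h : G) ∈ M) :
    average (annihilator hMH) (chiL2 H h) = chiL2 H h := by
  have sum_chi : ∑ ν : annihilator hMH, chi H h ν = (Nat.card (annihilator hMH) : ℂ) := by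
    simp [chi_of_mem_annihilator (Subtype.property _) hh]
  rw [average_chiL2, sum_chi, inv_mul_cancel₀ (Nat.cast_ne_zero.mpr Nat.card_pos.ne'), one_smul]

lemma average_chiL2_of_notMem {h : H} (hh : (h : G) ∉ M) :
    average (annihilator hMH) (chiL2 H h) = 0 := by
  rw [average_chiL2, sum_chi_of_notMem hh, mul_zero, zero_smul]

lemma hasSum_average (F : Lp ℂ 2 (dualHaar H)) :
    HasSum (fun m : M => ⟪chiL2 H (AddSubgroup.inclusion hMH m), F⟫_ℂ •
      chiL2 H (AddSubgroup.inclusion hMH m)) (average (annihilator hMH) F) := by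
  have hasSum_H := (hasSum_inner_chiL2_smul F).mapL (average (annihilator hMH))
  rw [← (AddSubgroup.inclusion_injective hMH).hasSum_iff] at hasSum_H
  · refine hasSum_H.congr_fun fun m => ?_
    rw [Function.comp_apply, map_smul, average_chiL2_of_mem (h := AddSubgroup.inclusion hMH m) m.2]
  · intro h hh
    rw [map_smul, average_chiL2_of_notMem fun hM => hh ⟨⟨h, hM⟩, rfl⟩, smul_zero]

lemma inner_chiL2_average (h : H) (F : Lp ℂ 2 (dualHaar H)) :
    ⟪chiL2 H h, average (annihilator hMH) F⟫_ℂ = ⟪average (annihilator hMH) (chiL2 H h), F⟫_ℂ := by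
  suffices innerSL ℂ (chiL2 H h) ∘L average (annihilator hMH) =
      innerSL ℂ (average (annihilator hMH) (chiL2 H h)) from DFunLike.congr_fun this F
  refine continuousLinearMap_ext_chiL2 fun k => ?_
  simp only [ContinuousLinearMap.comp_apply, innerSL_apply_apply]
  by_cases hh : (h : G) ∈ M <;> by_cases hk : (k : G) ∈ M
  · rw [average_chiL2_of_mem hh, average_chiL2_of_mem hk]
  · rw [average_chiL2_of_mem hh, average_chiL2_of_notMem hk, inner_zero_right,
      orthonormal_chiL2.2 fun h_eq : h = k => hk (h_eq ▸ hh)]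
  · rw [average_chiL2_of_notMem hh, average_chiL2_of_mem hk, inner_zero_left,
      orthonormal_chiL2.2 fun h_eq : h = k => hh (h_eq ▸ hk)]
  · rw [average_chiL2_of_notMem hh, average_chiL2_of_notMem hk, inner_zero_left, inner_zero_right]

lemma hasSum_norm_sq_inner_chiL2 (F : Lp ℂ 2 (dualHaar H)) :
    HasSum (fun m : M => ‖⟪chiL2 H (AddSubgroup.inclusion hMH m), F⟫_ℂ‖ ^ 2)
      (‖average (annihilator hMH) F‖ ^ 2) := by
  have hasSum_H := hasSum_norm_sq_inner_hilbertBasis (chiBasis H) (average (annihilator hMH) F)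
  simp only [coe_chiBasis, inner_chiL2_average] at hasSum_H
  rw [← (AddSubgroup.inclusion_injective hMH).hasSum_iff] at hasSum_H
  · refine hasSum_H.congr_fun fun m => ?_
    rw [Function.comp_apply, average_chiL2_of_mem (h := AddSubgroup.inclusion hMH m) m.2]
  · intro h hh
    rw [average_chiL2_of_notMem fun hM => hh ⟨⟨h, hM⟩, rfl⟩, inner_zero_left, norm_zero,
      zero_pow two_ne_zero]

end AnnihilatorAction

section TranslateMatrix

variable {G : Type*} [AddCommGroup G] [TopologicalSpace G] {H M : AddSubgroup G} {hMH : M ≤ H}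
  {s : ℕ} {Γ : Fin s → Dual H → ℂ}

lemma translateMatrix_eq_orbitMatrix :
    translateMatrix hMH Γ = orbitMatrix (annihilator hMH) Γ :=
  funext fun ξ => Matrix.ext fun j ν => congrArg (Γ j) (mul_comm ξ ν)

variable [IsTopologicalAddGroup G] [T2Space G] [IsUniformLattice H] [IsUniformLattice M]
  {Ω : Set (Dual H)}

lemma alphaConst_pos_iff : 0 < alphaConst hMH Γ Ω ↔ ∃ δ : ℝ, 0 < δ ∧
    ∀ᵐ ξ ∂(dualHaar H).restrict Ω, ∀ v : annihilator hMH → ℂ,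
      δ * ∑ ν, ‖v ν‖ ^ 2 ≤ ∑ j, ‖(translateMatrix hMH Γ ξ *ᵥ v) j‖ ^ 2 := by
  simp only [← le_lambdaMin_iff]
  constructor
  · intro h
    obtain ⟨δ, hδ, hδ_lt⟩ := ENNReal.lt_iff_exists_nnreal_btwn.mp h
    refine ⟨δ, by exact_mod_cast hδ, ?_⟩
    filter_upwards [ae_lt_of_lt_essInf hδ_lt] with ξ hξ
    exact (ENNReal.lt_ofReal_iff_toReal_lt ENNReal.coe_ne_top).mp hξ |>.le
  · rintro ⟨δ, hδ, hle⟩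
    exact (ENNReal.ofReal_pos.mpr hδ).trans_le (le_essInf_of_ae_le _
      (hle.mono fun ξ hξ => ENNReal.ofReal_le_ofReal hξ))

end TranslateMatrix

section Sampling

variable {G : Type*} [AddCommGroup G] [TopologicalSpace G] {H : AddSubgroup G}
  [DiscreteTopology H] {E : Type*} [NormedAddCommGroup E] [InnerProductSpace ℂ E]
  {ρ : Multiplicative G →* (E ≃L[ℂ] E)} {a b : E} {Φ : Dual H → ℂ}

lemma inner_chiL2_star (h : H) (w : Lp ℂ 2 (dualHaar H)) :
    ⟪chiL2 H h, star w⟫_ℂ = ⟪w, chiL2 H (-h)⟫_ℂ := by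
  rw [L2.inner_def, L2.inner_def]
  refine integral_congr_ae ?_
  filter_upwards [Lp.coeFn_star w, coeFn_chiL2 h, coeFn_chiL2 (-h)] with ξ h_star h_chi h_neg
  rw [h_star, h_chi, h_neg, chi_neg, RCLike.inner_apply', RCLike.inner_apply, Pi.star_apply,
    starRingEnd_apply (_ : ℂ), starRingEnd_apply (_ : ℂ)]

lemma mulOp_chiL2 (hΦ : MemLp Φ ∞ (dualHaar H)) (h : H) :
    mulOp hΦ (chiL2 H h) = mulOp (memLp_chi h) (linftyToL2 H Φ hΦ) := by
  refine Lp.ext ?_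
  filter_upwards [coeFn_mulOp hΦ (chiL2 H h), coeFn_mulOp (memLp_chi h) (linftyToL2 H Φ hΦ),
    coeFn_chiL2 h, (hΦ.mono_exponent le_top : MemLp Φ 2 (dualHaar H)).coeFn_toLp]
    with ξ h_left h_right h_chi h_toLp
  rw [h_left, h_right, h_chi, linftyToL2, h_toLp, mul_comm]

lemma inner_chiL2_mulOp (hΦ : MemLp Φ ∞ (dualHaar H)) {w : Lp ℂ 2 (dualHaar H)}
    (hΦw : Φ =ᵐ[dualHaar H] (star w : Lp ℂ 2 (dualHaar H))) (h : H) (F : Lp ℂ 2 (dualHaar H)) :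
    ⟪chiL2 H h, mulOp hΦ F⟫_ℂ = ⟪w, mulOp (memLp_chi (-h)) F⟫_ℂ := by
  rw [L2.inner_def, L2.inner_def]
  refine integral_congr_ae ?_
  filter_upwards [coeFn_mulOp hΦ F, coeFn_mulOp (memLp_chi (-h)) F, coeFn_chiL2 h, hΦw,
    Lp.coeFn_star w] with ξ h_left h_right h_chi h_w h_star
  rw [h_left, h_right, h_chi, h_w, h_star, chi_neg, RCLike.inner_apply, RCLike.inner_apply,
    Pi.star_apply, ← starRingEnd_apply]
  ring

omit [TopologicalSpace G] in
lemma op_add (g g' : G) (x : E) : op ρ (g + g') x = op ρ g (op ρ g' x) := by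
  simp only [op, ofAdd_add, map_mul]
  rfl

variable [CompleteSpace E]

omit [TopologicalSpace G] in
lemma sample_eq_inner (b x : E) (g : G) : sample ρ b x g = ⟪b, op ρ (-g) x⟫_ℂ := by
  rw [sample, ContinuousLinearMap.adjoint_inner_left]

variable (ha : IsRieszSequence fun h : H => op ρ h a)

/-- The map `𝒯_{H,a}` as a bounded operator on `L²` of the dual group. -/
def synthOp : Lp ℂ 2 (dualHaar H) →L[ℂ] E := ha.synthesis (chiBasis H)

lemma synthOp_apply (F : Lp ℂ 2 (dualHaar H)) : synthOp ha F = synth ρ H a F := by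
  rw [synthOp, ha.synthesis_apply, coe_chiBasis, synth]

lemma synthOp_chiL2 (h : H) : synthOp ha (chiL2 H h) = op ρ h a := by
  rw [← coe_chiBasis, synthOp, ha.synthesis_basis]

lemma range_synthOp : (synthOp ha).range = genSubspace ρ H a :=
  ha.range_synthesis (chiBasis H)

lemma synthOp_mem (F : Lp ℂ 2 (dualHaar H)) : synthOp ha F ∈ genSubspace ρ H a :=
  range_synthOp ha ▸ ⟨F, rfl⟩

lemma exists_synthOp_eq {x : E} (hx : x ∈ genSubspace ρ H a) : ∃ F, synthOp ha F = x := by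
  rwa [← range_synthOp ha] at hx

lemma exists_leftInverse_synthOp :
    ∃ S : E →L[ℂ] Lp ℂ 2 (dualHaar H), ∀ F, S (synthOp ha F) = F :=
  let ⟨_, hK⟩ := ha.exists_antilipschitzWith_synthesis (chiBasis H)
  exists_leftInverse_of_antilipschitzWith hK

lemma synthOp_mulOp_chi (h : H) (F : Lp ℂ 2 (dualHaar H)) :
    synthOp ha (mulOp (memLp_chi h) F) = op ρ h (synthOp ha F) := by
  suffices synthOp ha ∘L mulOp (memLp_chi h) = op ρ h ∘L synthOp ha from DFunLike.congr_fun this F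
  refine continuousLinearMap_ext_chiL2 fun k => ?_
  rw [ContinuousLinearMap.comp_apply, ContinuousLinearMap.comp_apply, mulOp_chi_chiL2,
    synthOp_chiL2, synthOp_chiL2, AddSubgroup.coe_add, op_add]

include ha in
lemma op_mem_genSubspace {x : E} (hx : x ∈ genSubspace ρ H a) (h : H) :
    op ρ h x ∈ genSubspace ρ H a := by
  obtain ⟨F, rfl⟩ := exists_synthOp_eq ha hx
  rw [← synthOp_mulOp_chi]
  exact synthOp_mem ha _

lemma op_synthOp_linftyToL2 (hΦ : MemLp Φ ∞ (dualHaar H)) (h : H) :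
    op ρ h (synthOp ha (linftyToL2 H Φ hΦ)) = synthOp ha (mulOp hΦ (chiL2 H h)) := by
  rw [mulOp_chiL2, synthOp_mulOp_chi]

lemma sampleFun_eq_star_adjoint : sampleFun ρ H a b = star ((synthOp ha).adjoint b) := by
  refine HasSum.tsum_eq ((hasSum_inner_chiL2_smul _).congr_fun fun h => ?_)
  rw [inner_chiL2_star, ContinuousLinearMap.adjoint_inner_left, synthOp_chiL2, sample_eq_inner,
    AddSubgroup.coe_neg]

lemma sample_synthOp (hΦ : MemLp Φ ∞ (dualHaar H)) (hΦb : Φ =ᵐ[dualHaar H] sampleFun ρ H a b)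
    (F : Lp ℂ 2 (dualHaar H)) (h : H) :
    sample ρ b (synthOp ha F) h = ⟪chiL2 H h, mulOp hΦ F⟫_ℂ := by
  rw [sampleFun_eq_star_adjoint ha] at hΦb
  rw [inner_chiL2_mulOp hΦ hΦb, ContinuousLinearMap.adjoint_inner_left, synthOp_mulOp_chi,
    sample_eq_inner, AddSubgroup.coe_neg]

end Sampling

section SamplingSeries

lemma hasSum_prod_of_fintype {ι κ V : Type*} [Fintype κ] [AddCommMonoid V] [TopologicalSpace V]
    [ContinuousAdd V] {f : κ × ι → V} {g : κ → V} (hf : ∀ j, HasSum (fun i => f (j, i)) (g j)) :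
    HasSum f (∑ j, g j) := by
  classical
  have hasSum_row : ∀ j, HasSum (fun p : κ × ι => if p.1 = j then f p else 0) (g j) := fun j => by
    rw [← (Prod.mk_right_injective j).hasSum_iff]
    · simpa [Function.comp_def] using hf j
    · rintro ⟨j', i⟩ hp
      exact if_neg fun h_eq => hp ⟨i, Prod.ext h_eq.symm rfl⟩
  simpa using hasSum_sum fun j (_ : j ∈ Finset.univ) => hasSum_row j

variable {G : Type*} [AddCommGroup G] [TopologicalSpace G] {H M : AddSubgroup G}
  [DiscreteTopology H] {hMH : M ≤ H} {E : Type*} [NormedAddCommGroup E] [InnerProductSpace ℂ E]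
  {ρ : Multiplicative G →* (E ≃L[ℂ] E)} {a : E}

variable [CompleteSpace E] {κ : Type*} {b : κ → E} {Γ F : κ → Dual H → ℂ}
  (ha : IsRieszSequence fun h : H => op ρ h a)

include ha hMH in
lemma exists_isBessel_inner_eq_sample [Finite κ] (hΓ : ∀ j, MemLp (Γ j) ∞ (dualHaar H))
    (hΓb : ∀ j, Γ j =ᵐ[dualHaar H] sampleFun ρ H a (b j)) :
    ∃ g : κ × M → E, IsBessel g ∧
      ∀ x ∈ genSubspace ρ H a, ∀ p : κ × M, sample ρ (b p.1) x p.2 = ⟪g p, x⟫_ℂ := by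
  obtain ⟨S, hS⟩ := exists_leftInverse_synthOp ha
  let g : κ × M → E := fun p =>
    (mulOp (hΓ p.1) ∘L S).adjoint (chiL2 H (AddSubgroup.inclusion hMH p.2))
  have isBessel_chi : IsBessel (chiL2 H ∘ AddSubgroup.inclusion hMH) :=
    (isBessel_of_orthonormal orthonormal_chiL2).comp_injective
      (AddSubgroup.inclusion_injective hMH)
  have isBessel_row : ∀ j, IsBessel fun m => g (j, m) := fun j =>
    isBessel_chi.map (mulOp (hΓ j) ∘L S).adjoint
  refine ⟨g, IsBessel.prod isBessel_row, fun x hx p => ?_⟩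
  obtain ⟨f, rfl⟩ := exists_synthOp_eq ha hx
  rw [ContinuousLinearMap.adjoint_inner_left, ContinuousLinearMap.comp_apply, hS]
  exact sample_synthOp ha (hΓ p.1) (hΓb p.1) f (AddSubgroup.inclusion hMH p.2)

include hMH in
lemma isBessel_op_synthOp_linftyToL2 [Finite κ] (hF : ∀ j, MemLp (F j) ∞ (dualHaar H)) :
    IsBessel fun p : κ × M => op ρ p.2 (synthOp ha (linftyToL2 H (F p.1) (hF p.1))) := by
  refine IsBessel.prod fun j => ?_
  have := ((isBessel_of_orthonormal orthonormal_chiL2).comp_injective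
    (AddSubgroup.inclusion_injective hMH)).map (synthOp ha ∘L mulOp (hF j))
  simpa only [Function.comp_def, ContinuousLinearMap.comp_apply, ← op_synthOp_linftyToL2,
    AddSubgroup.coe_inclusion] using this

variable [Fintype κ] [Fintype (annihilator hMH)]

lemma hasSum_norm_sq_sample (hΓ : ∀ j, MemLp (Γ j) ∞ (dualHaar H))
    (hΓb : ∀ j, Γ j =ᵐ[dualHaar H] sampleFun ρ H a (b j)) (f : Lp ℂ 2 (dualHaar H)) :
    HasSum (fun p : κ × M => ‖sample ρ (b p.1) (synthOp ha f) p.2‖ ^ 2)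
      (∑ j, ‖average (annihilator hMH) (mulOp (hΓ j) f)‖ ^ 2) := by
  refine hasSum_prod_of_fintype fun j => ?_
  simpa only [← sample_synthOp ha (hΓ j) (hΓb j), AddSubgroup.coe_inclusion] using
    hasSum_norm_sq_inner_chiL2 (hMH := hMH) (mulOp (hΓ j) f)

lemma hasSum_sample_smul_op (hΓ : ∀ j, MemLp (Γ j) ∞ (dualHaar H))
    (hΓb : ∀ j, Γ j =ᵐ[dualHaar H] sampleFun ρ H a (b j))
    (hF : ∀ j, MemLp (F j) ∞ (dualHaar H)) (f : Lp ℂ 2 (dualHaar H)) :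
    HasSum (fun p : κ × M => sample ρ (b p.1) (synthOp ha f) p.2 •
        op ρ p.2 (synthOp ha
          ((Nat.card (annihilator hMH) : ℂ) • linftyToL2 H (F p.1) (hF p.1))))
      (synthOp ha (reconstruction (annihilator hMH) hF hΓ f)) := by
  have reconstruction_apply : reconstruction (annihilator hMH) hF hΓ f =
      ∑ j, (Nat.card (annihilator hMH) : ℂ) •
        mulOp (hF j) (average (annihilator hMH) (mulOp (hΓ j) f)) := by
    simp only [reconstruction, _root_.smul_apply, _root_.sum_apply, ContinuousLinearMap.comp_apply,
      Finset.smul_sum]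
  rw [reconstruction_apply, map_sum]
  refine hasSum_prod_of_fintype fun j => ?_
  rw [map_smul]
  refine (((hasSum_average (mulOp (hΓ j) f)).mapL (synthOp ha ∘L mulOp (hF j))).const_smul
    _).congr_fun fun m => ?_
  rw [map_smul, map_smul, map_smul, ContinuousLinearMap.comp_apply, ← op_synthOp_linftyToL2,
    ← sample_synthOp ha (hΓ j) (hΓb j), smul_comm]
  rfl

end SamplingSeries

section Equivalences

variable {G : Type*} [AddCommGroup G] [TopologicalSpace G] {H M : AddSubgroup G}
  [DiscreteTopology H] {hMH : M ≤ H} {Ω : Set (Dual H)} {s : ℕ} {Γ F : Fin s → Dual H → ℂ}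
  {E : Type*} [NormedAddCommGroup E] [InnerProductSpace ℂ E] [CompleteSpace E]
  {ρ : Multiplicative G →* (E ≃L[ℂ] E)} {a : E} {b c : Fin s → E}

omit [DiscreteTopology H] in
instance : CompleteSpace (genSubspace ρ H a) :=
  (Submodule.isClosed_topologicalClosure _).completeSpace_coe

lemma IsSection.ae_vecMul_translateMatrix_eq_firstRow_iff [Fintype (annihilator hMH)]
    (hΩ : IsSection hMH Ω) (hF : ∀ j, MemLp (F j) ∞ (dualHaar H))
    (hΓ : ∀ j, MemLp (Γ j) ∞ (dualHaar H)) :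
    (∀ᵐ ξ ∂(dualHaar H), (fun j => F j ξ) ᵥ* translateMatrix hMH Γ ξ = firstRow hMH) ↔
      ∀ f, reconstruction (annihilator hMH) hF hΓ f = f := by
  classical
  rw [reconstruction_eq_self_iff hΩ.isFundamentalDomain hΩ.measurableSet,
    translateMatrix_eq_orbitMatrix]
  rfl

lemma IsSection.memLp_top_of_isBessel_op_synthOp [Finite (annihilator hMH)]
    (hΩ : IsSection hMH Ω) (ha : IsRieszSequence fun h : H => op ρ h a)
    {f : Lp ℂ 2 (dualHaar H)}
    (hf : IsBessel fun m : M => op ρ m (synthOp ha f)) : MemLp f ∞ (dualHaar H) := by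
  have := Fintype.ofFinite (annihilator hMH)
  obtain ⟨S, hS⟩ := exists_leftInverse_synthOp ha
  obtain ⟨B, hB, hBf⟩ := hf.map S
  have op_eq : ∀ m : M, S (op ρ m (synthOp ha f)) =
      mulOp (memLp_chi (AddSubgroup.inclusion hMH m)) f := fun m => by
    rw [← hS (mulOp _ f), synthOp_mulOp_chi, AddSubgroup.coe_inclusion]
  suffices MemLp (star f : Lp ℂ 2 (dualHaar H)) ∞ (dualHaar H) by
    refine this.star.ae_eq ?_
    filter_upwards [Lp.coeFn_star f] with ξ hξ
    rw [Pi.star_apply, hξ, Pi.star_apply, star_star]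
  refine memLp_top_of_average_mulOp_le hΩ.isFundamentalDomain hΩ.measurableSet hB fun g hg => ?_
  have inner_eq : ∀ m : M, ⟪S (op ρ m (synthOp ha f)), (hg.mono_exponent le_top).toLp g⟫_ℂ =
      ⟪chiL2 H (AddSubgroup.inclusion hMH m), mulOp hg (star f)⟫_ℂ := fun m => by
    rw [op_eq, inner_mulOp_toLp_star]
    rfl
  refine hasSum_le_of_sum_le (hasSum_norm_sq_inner_chiL2 _) fun t => ?_
  simpa only [inner_eq] using hBf ((hg.mono_exponent le_top).toLp g) t

lemma IsSection.isFrameFor_and_hasSum_of_vecMul_eq_firstRow [Finite (annihilator hMH)]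
    (hΩ : IsSection hMH Ω) (ha : IsRieszSequence fun h : H => op ρ h a)
    (hΓ : ∀ j, MemLp (Γ j) ∞ (dualHaar H))
    (hΓb : ∀ j, Γ j =ᵐ[dualHaar H] sampleFun ρ H a (b j)) (hF : ∀ j, MemLp (F j) ∞ (dualHaar H))
    (hFΓ : ∀ᵐ ξ ∂(dualHaar H), (fun j => F j ξ) ᵥ* translateMatrix hMH Γ ξ = firstRow hMH)
    (hc : ∀ j, c j =
      synthOp ha ((Nat.card (annihilator hMH) : ℂ) • linftyToL2 H (F j) (hF j))) :
    IsFrameFor (fun p : Fin s × M => op ρ p.2 (c p.1)) (genSubspace ρ H a) ∧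
      ∀ x ∈ genSubspace ρ H a,
        HasSum (fun p : Fin s × M => sample ρ (b p.1) x p.2 • op ρ p.2 (c p.1)) x := by
  have := Fintype.ofFinite (annihilator hMH)
  have hrec : ∀ x ∈ genSubspace ρ H a,
      HasSum (fun p : Fin s × M => sample ρ (b p.1) x p.2 • op ρ p.2 (c p.1)) x := fun x hx => by
    obtain ⟨f, rfl⟩ := exists_synthOp_eq ha hx
    have hasSum_f := hasSum_sample_smul_op (hMH := hMH) ha hΓ hΓb hF f
    rw [(hΩ.ae_vecMul_translateMatrix_eq_firstRow_iff hF hΓ).mp hFΓ f] at hasSum_f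
    simpa only [hc] using hasSum_f
  have op_mem : ∀ p : Fin s × M, op ρ p.2 (c p.1) ∈ genSubspace ρ H a := fun p =>
    op_mem_genSubspace ha (hc p.1 ▸ synthOp_mem ha _) (AddSubgroup.inclusion hMH p.2)
  have isBessel_op : IsBessel fun p : Fin s × M => op ρ p.2 (c p.1) := by
    simp only [hc]
    exact isBessel_op_synthOp_linftyToL2 (hMH := hMH) ha
      fun j => (hF j).const_smul (Nat.card (annihilator hMH) : ℂ)
  obtain ⟨g, isBessel_g, sample_eq⟩ :=
    exists_isBessel_inner_eq_sample (hMH := hMH) ha hΓ hΓb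
  exact ⟨.of_isBessel_of_hasSum op_mem isBessel_op isBessel_g fun x hx => by
    simpa only [sample_eq x hx] using hrec x hx, hrec⟩

lemma IsSection.exists_vecMul_eq_firstRow_of_isBessel [Finite (annihilator hMH)]
    (hΩ : IsSection hMH Ω) (ha : IsRieszSequence fun h : H => op ρ h a)
    (hΓ : ∀ j, MemLp (Γ j) ∞ (dualHaar H))
    (hΓb : ∀ j, Γ j =ᵐ[dualHaar H] sampleFun ρ H a (b j))
    (hc : ∀ j, c j ∈ genSubspace ρ H a)
    (hc_bessel : IsBessel fun p : Fin s × M => op ρ p.2 (c p.1))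
    (hrec : ∀ x ∈ genSubspace ρ H a,
      HasSum (fun p : Fin s × M => sample ρ (b p.1) x p.2 • op ρ p.2 (c p.1)) x) :
    ∃ (F : Fin s → Dual H → ℂ) (hF : ∀ j, MemLp (F j) ∞ (dualHaar H)),
      (∀ᵐ ξ ∂(dualHaar H), (fun j => F j ξ) ᵥ* translateMatrix hMH Γ ξ = firstRow hMH) ∧
      ∀ j, c j = synth ρ H a
        ((Nat.card (annihilator hMH) : ℂ) • linftyToL2 H (F j) (hF j)) := by
  have := Fintype.ofFinite (annihilator hMH)
  choose f hf using fun j => exists_synthOp_eq ha (hc j)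
  have hf_top : ∀ j, MemLp (f j) ∞ (dualHaar H) := fun j => by
    refine hΩ.memLp_top_of_isBessel_op_synthOp ha ?_
    simpa only [hf, Function.comp_def] using hc_bessel.comp_injective (Prod.mk_right_injective j)
  have hF := fun j => (hf_top j).const_smul (Nat.card (annihilator hMH) : ℂ)⁻¹
  have card_smul : ∀ j, (Nat.card (annihilator hMH) : ℂ) • linftyToL2 H _ (hF j) = f j :=
    fun j => by
      rw [linftyToL2, MemLp.toLp_const_smul _ ((hf_top j).mono_exponent le_top), Lp.toLp_coeFn,
        smul_inv_smul₀ (Nat.cast_ne_zero.mpr Nat.card_pos.ne')]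
  refine ⟨_, hF, ?_, fun j => ?_⟩
  · obtain ⟨S, hS⟩ := exists_leftInverse_synthOp ha
    refine (hΩ.ae_vecMul_translateMatrix_eq_firstRow_iff hF hΓ).mpr fun g => ?_
    refine (Function.LeftInverse.injective hS)
      ((hasSum_sample_smul_op ha hΓ hΓb hF g).unique ?_)
    simpa only [card_smul, hf] using hrec _ (synthOp_mem ha g)
  · rw [card_smul, ← synthOp_apply ha, hf]

lemma exists_norm_sq_le_sum_of_isBessel [Fintype (annihilator hMH)]
    (ha : IsRieszSequence fun h : H => op ρ h a) (hΓ : ∀ j, MemLp (Γ j) ∞ (dualHaar H))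
    (hΓb : ∀ j, Γ j =ᵐ[dualHaar H] sampleFun ρ H a (b j)) {C : Fin s × M → E} (hC : IsBessel C)
    (hrec : ∀ x ∈ genSubspace ρ H a,
      HasSum (fun p : Fin s × M => sample ρ (b p.1) x p.2 • C p) x) :
    ∃ B : ℝ, 0 ≤ B ∧ ∀ f : Lp ℂ 2 (dualHaar H),
      ‖f‖ ^ 2 ≤ B * ∑ j, ‖average (annihilator hMH) (mulOp (hΓ j) f)‖ ^ 2 := by
  obtain ⟨S, hS⟩ := exists_leftInverse_synthOp ha
  obtain ⟨B, hB, norm_sq_le⟩ := hC.exists_norm_sq_le_of_hasSum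
  refine ⟨‖S‖ ^ 2 * B, by positivity, fun f => ?_⟩
  calc ‖f‖ ^ 2 = ‖S (synthOp ha f)‖ ^ 2 := by rw [hS]
    _ ≤ (‖S‖ * ‖synthOp ha f‖) ^ 2 := by gcongr; exact S.le_opNorm _
    _ = ‖S‖ ^ 2 * ‖synthOp ha f‖ ^ 2 := mul_pow _ _ _
    _ ≤ ‖S‖ ^ 2 * (B * ∑ j, ‖average (annihilator hMH) (mulOp (hΓ j) f)‖ ^ 2) := by
      gcongr
      exact norm_sq_le _ _ _ (hrec _ (synthOp_mem ha f)) (hasSum_norm_sq_sample ha hΓ hΓb f)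
    _ = ‖S‖ ^ 2 * B * ∑ j, ‖average (annihilator hMH) (mulOp (hΓ j) f)‖ ^ 2 :=
      (mul_assoc _ _ _).symm

end Equivalences

section SmallestEigenvalueBound

variable {G : Type*} [AddCommGroup G] [TopologicalSpace G] [IsTopologicalAddGroup G] [T2Space G]
  {H M : AddSubgroup G} [IsUniformLattice H] [IsUniformLattice M] {hMH : M ≤ H}
  {Ω : Set (Dual H)} {s : ℕ} {Γ : Fin s → Dual H → ℂ}

lemma IsSection.exists_vecMul_eq_firstRow (hΩ : IsSection hMH Ω)
    (hΓ : ∀ j, MemLp (Γ j) ∞ (dualHaar H)) (hα : 0 < alphaConst hMH Γ Ω) :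
    ∃ F : Fin s → Dual H → ℂ, (∀ j, MemLp (F j) ∞ (dualHaar H)) ∧
      ∀ᵐ ξ ∂(dualHaar H), (fun j => F j ξ) ᵥ* translateMatrix hMH Γ ξ = firstRow hMH := by
  classical
  obtain ⟨δ, hδ, hle⟩ := alphaConst_pos_iff.mp hα
  rw [translateMatrix_eq_orbitMatrix] at hle ⊢
  exact exists_vecMul_orbitMatrix_eq_single hΩ.isFundamentalDomain hΓ hδ hle

lemma IsSection.alphaConst_pos (hΩ : IsSection hMH Ω) (hΓ : ∀ j, MemLp (Γ j) ∞ (dualHaar H))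
    {B : ℝ} (hB : 0 ≤ B) (hle : ∀ f : Lp ℂ 2 (dualHaar H),
      ‖f‖ ^ 2 ≤ B * ∑ j, ‖average (annihilator hMH) (mulOp (hΓ j) f)‖ ^ 2) :
    0 < alphaConst hMH Γ Ω := by
  have hcard : (0 : ℝ) < Nat.card (annihilator hMH) := Nat.cast_pos.mpr Nat.card_pos
  refine alphaConst_pos_iff.mpr ⟨Nat.card (annihilator hMH) / (B + 1), by positivity, ?_⟩
  rw [translateMatrix_eq_orbitMatrix]
  filter_upwards [ae_forall_card_mul_sum_norm_sq_le hΩ.isFundamentalDomain hΩ.measurableSet hΓ hB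
    hle] with ξ hξ v
  rw [div_mul_eq_mul_div, div_le_iff₀' (by positivity)]
  exact (hξ v).trans (by gcongr; linarith)

end SmallestEigenvalueBound

end LCASampling

end

open LCASampling in
theorem mainTheorem3_general
    {G : Type*} [AddCommGroup G] [TopologicalSpace G] [IsTopologicalAddGroup G]
    [T2Space G] (M H : AddSubgroup G) (hMH : M ≤ H)
    [IsUniformLattice M] [IsUniformLattice H]
    {E : Type*} [NormedAddCommGroup E] [InnerProductSpace ℂ E] [CompleteSpace E]
    (ρ : Multiplicative G →* (E ≃L[ℂ] E)) (a : E)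
    (ha : IsRieszSequence fun h : H => op ρ h a)
    (Ω : Set (Dual H)) (hΩ : IsSection hMH Ω)
    (s : ℕ) (b : Fin s → E) (Γ : Fin s → Dual H → ℂ)
    (hΓ : ∀ j, Γ j =ᵐ[dualHaar H] sampleFun ρ H a (b j))
    (hΓ_bdd : ∀ j, MemLp (Γ j) ∞ (dualHaar H)) :
    List.TFAE [
      0 < alphaConst hMH Γ Ω,
      ∃ F : Fin s → Dual H → ℂ, (∀ j, MemLp (F j) ∞ (dualHaar H)) ∧
        ∀ᵐ ξ ∂(dualHaar H), (fun j => F j ξ) ᵥ* translateMatrix hMH Γ ξ = firstRow hMH,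
      ∃ c : Fin s → E, (∀ j, c j ∈ genSubspace ρ H a) ∧
        IsFrameFor (fun p : Fin s × M => op ρ p.2 (c p.1)) (genSubspace ρ H a) ∧
        ∀ x ∈ genSubspace ρ H a,
          HasSum (fun p : Fin s × M => sample ρ (b p.1) x p.2 • op ρ p.2 (c p.1)) x,
      ∃ C : Fin s × M → E, IsFrameFor C (genSubspace ρ H a) ∧
        ∀ x ∈ genSubspace ρ H a,
          HasSum (fun p : Fin s × M => sample ρ (b p.1) x p.2 • C p) x] ∧
    ∀ c : Fin s → E, (∀ j, c j ∈ genSubspace ρ H a) →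
      IsFrameFor (fun p : Fin s × M => op ρ p.2 (c p.1)) (genSubspace ρ H a) →
      (∀ x ∈ genSubspace ρ H a,
        HasSum (fun p : Fin s × M => sample ρ (b p.1) x p.2 • op ρ p.2 (c p.1)) x) →
      ∃ (F : Fin s → Dual H → ℂ) (hF : ∀ j, MemLp (F j) ∞ (dualHaar H)),
        (∀ᵐ ξ ∂(dualHaar H), (fun j => F j ξ) ᵥ* translateMatrix hMH Γ ξ = firstRow hMH) ∧
        ∀ j, c j = synth ρ H a
          ((Nat.card (annihilator hMH) : ℂ) • linftyToL2 H (F j) (hF j)) := by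
  refine ⟨?_, fun c hc hframe hrec =>
    hΩ.exists_vecMul_eq_firstRow_of_isBessel ha hΓ_bdd hΓ hc hframe.isBessel hrec⟩
  tfae_have 1 → 2 := hΩ.exists_vecMul_eq_firstRow hΓ_bdd
  tfae_have 2 → 3
  | ⟨F, hF, hFΓ⟩ =>
    ⟨fun j => synthOp ha ((Nat.card (annihilator hMH) : ℂ) • linftyToL2 H (F j) (hF j)),
      fun _ => synthOp_mem ha _,
      hΩ.isFrameFor_and_hasSum_of_vecMul_eq_firstRow ha hΓ_bdd hΓ hF hFΓ fun _ => rfl⟩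
  tfae_have 3 → 4 := fun ⟨c, _, hframe, hrec⟩ => ⟨_, hframe, hrec⟩
  tfae_have 4 → 1
  | ⟨C, hframe, hrec⟩ =>
    have ⟨_, hB, norm_sq_le⟩ := exists_norm_sq_le_sum_of_isBessel ha hΓ_bdd hΓ hframe.isBessel hrec
    hΩ.alphaConst_pos hΓ_bdd hB norm_sq_le
  tfae_finish

open LCASampling in
theorem mainTheorem3
    {G : Type*} [AddCommGroup G] [TopologicalSpace G] [IsTopologicalAddGroup G]
    [LocallyCompactSpace G] [T2Space G] [SecondCountableTopology G]
    (M H : AddSubgroup G) (hMH : M ≤ H) [Countable M] [Countable H]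
    [IsUniformLattice M] [IsUniformLattice H]
    {E : Type*} [NormedAddCommGroup E] [InnerProductSpace ℂ E] [CompleteSpace E]
    [TopologicalSpace.SeparableSpace E]
    (ρ : Multiplicative G →* (E ≃L[ℂ] E)) (a : E)
    (ha : IsRieszSequence fun h : H => op ρ h a)
    (Ω : Set (Dual H)) (hΩ : IsSection hMH Ω)
    (s : ℕ) (b : Fin s → E) (Γ : Fin s → Dual H → ℂ)
    (hΓ : ∀ j, Γ j =ᵐ[dualHaar H] sampleFun ρ H a (b j))
    (hΓ_bdd : ∀ j, MemLp (Γ j) ∞ (dualHaar H)) :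
    List.TFAE [
      0 < alphaConst hMH Γ Ω,
      ∃ F : Fin s → Dual H → ℂ, (∀ j, MemLp (F j) ∞ (dualHaar H)) ∧
        ∀ᵐ ξ ∂(dualHaar H), (fun j => F j ξ) ᵥ* translateMatrix hMH Γ ξ = firstRow hMH,
      ∃ c : Fin s → E, (∀ j, c j ∈ genSubspace ρ H a) ∧
        IsFrameFor (fun p : Fin s × M => op ρ p.2 (c p.1)) (genSubspace ρ H a) ∧
        ∀ x ∈ genSubspace ρ H a,
          HasSum (fun p : Fin s × M => sample ρ (b p.1) x p.2 • op ρ p.2 (c p.1)) x,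
      ∃ C : Fin s × M → E, IsFrameFor C (genSubspace ρ H a) ∧
        ∀ x ∈ genSubspace ρ H a,
          HasSum (fun p : Fin s × M => sample ρ (b p.1) x p.2 • C p) x] ∧
    ∀ c : Fin s → E, (∀ j, c j ∈ genSubspace ρ H a) →
      IsFrameFor (fun p : Fin s × M => op ρ p.2 (c p.1)) (genSubspace ρ H a) →
      (∀ x ∈ genSubspace ρ H a,
        HasSum (fun p : Fin s × M => sample ρ (b p.1) x p.2 • op ρ p.2 (c p.1)) x) →
      ∃ (F : Fin s → Dual H → ℂ) (hF : ∀ j, MemLp (F j) ∞ (dualHaar H)),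
        (∀ᵐ ξ ∂(dualHaar H), (fun j => F j ξ) ᵥ* translateMatrix hMH Γ ξ = firstRow hMH) ∧
        ∀ j, c j = synth ρ H a
          ((Nat.card (annihilator hMH) : ℂ) • linftyToL2 H (F j) (hF j)) :=
  mainTheorem3_general M H hMH ρ a ha Ω hΩ s b Γ hΓ hΓ_bdd
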